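/- Let $k$ be a field of characteristic $p>0$ with $[k:k^p]<\infty$, let $S=k[x_0,\dots,x_n]$ with its standard grading, and let $\mathfrak m=(x_0,\dots,x_n)$. Let $f_1,\dots,f_c\in S$ be homogeneous polynomials forming a regular sequence, and put $J=(f_1,\dots,f_c)$, $R=S/J$ and $d=\sum_{j=1}^c\deg(f_j)$. Let $\mathrm{Jac}(R)\subseteq S$ be the ideal generated by the $c\times c$ minors of the Jacobian matrix $(\partial f_j/\partial x_i)$, $0\le i\le n$, $1\le j\le c$. Suppose that $\sqrt{\mathrm{Jac}(R)+J}=\mathfrak m$ and that $p\ge (n+1-c)(d-c)$. Then the Frobenius action $F$ on the $\mathbb Z$-graded local cohomology module $H^{n+1-c}_{\mathfrak m}(R)$ (the map induced by the Frobenius endomorphism of $R$, which may be computed on the Čech complex of $x_0,\dots,x_n$) maps the part of negative degree into itself, and $$F: H^{n+1-c}_{\mathfrak m}(R)_{<0}\longrightarrow H^{n+1-c}_{\mathfrak m}(R)_{<0}$$ is injective. -/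

import Mathlib

noncomputable section

/-! ### Frobenius on rings in which a prime `p` vanishes (possibly the zero ring) -/

/-- The Frobenius endomorphism `z ↦ z ^ p` of a commutative ring `B` with `p = 0` in `B`. -/
def frobHom {B : Type*} [CommRing B] (p : ℕ) [hp : Fact p.Prime] (h : (p : B) = 0) : B →+* B where
  toFun z := z ^ p
  map_one' := one_pow p
  map_mul' a b := mul_pow a b p
  map_zero' := zero_pow hp.out.ne_zero
  map_add' a b := by
    obtain ⟨r, hr⟩ := exists_add_pow_prime_eq hp.out a b
    rw [hr, h]
    ring

/-! ### Local cohomology through the Čech complex -/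

namespace Cech

variable {A : Type*} [CommRing A] {ι : Type*}

/-- The localization of `A` at the product of the `x i`, `i ∈ T`. -/
abbrev Loc (x : ι → A) (T : Finset ι) : Type _ :=
  Localization.Away (∏ i ∈ T, x i)

theorem isUnit_prod (x : ι → A) {T U : Finset ι} (h : T ⊆ U) :
    IsUnit (Algebra.ofId A (Loc x U) (∏ i ∈ T, x i)) :=
  IsLocalization.Away.isUnit_of_dvd (S := Loc x U) (∏ i ∈ U, x i)
    (Finset.prod_dvd_prod_of_subset T U x h)

/-- The canonical localization map `A_{x_T} → A_{x_U}` for `T ⊆ U`. -/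
def res (x : ι → A) {T U : Finset ι} (h : T ⊆ U) : Loc x T →ₐ[A] Loc x U :=
  IsLocalization.Away.liftAlgHom (∏ i ∈ T, x i) (f := Algebra.ofId A (Loc x U)) (isUnit_prod x h)

theorem res_res (x : ι → A) {T U V : Finset ι} (h : T ⊆ U) (h' : U ⊆ V) (z : Loc x T) :
    res x h' (res x h z) = res x (h.trans h') z := by
  have : (res x h').comp (res x h) = res x (h.trans h') :=
    (IsLocalization.algHom_subsingleton (Submonoid.powers (∏ i ∈ T, x i))).elim _ _
  exact DFunLike.congr_fun this z

theorem natCast_loc (x : ι → A) {p : ℕ} (h : (p : A) = 0) (T : Finset ι) :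
    (p : Loc x T) = 0 := by
  rw [← map_natCast (algebraMap A (Loc x T)), h, map_zero]

/-- Čech cochains of degree `q`: the product of the localizations `A_{x_T}` over all `q`-element
subsets `T` of the index set. In degree `0` this is `A` itself. -/
abbrev Cochain (x : ι → A) (q : ℕ) : Type _ :=
  (T : {T : Finset ι // T.card = q}) → Loc x T.1

variable [LinearOrder ι]

/-- The face of a `(q+1)`-element set obtained by leaving out the element `i`. -/
def face {q : ℕ} (T : {T : Finset ι // T.card = q + 1}) (i : T.1) :
    {T : Finset ι // T.card = q} :=
  ⟨T.1.erase i.1, by rw [Finset.card_erase_of_mem i.2, T.2]; rfl⟩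

theorem face_subset {q : ℕ} (T : {T : Finset ι // T.card = q + 1}) (i : T.1) :
    (face T i).1 ⊆ T.1 :=
  Finset.erase_subset i.1 T.1

/-- The position of `i` in the set `T`, counted from `0`. -/
def pos (T : Finset ι) (i : ι) : ℕ := (T.filter (· < i)).card

/-- The Čech differential
`(d ω)_T = ∑_{i ∈ T} (-1)^{pos T i} ω_{T ∖ {i}} |_T`. -/
def d (x : ι → A) (q : ℕ) : Cochain x q →ₗ[A] Cochain x (q + 1) :=
  LinearMap.pi fun T => ∑ i : T.1, (-1 : A) ^ pos T.1 i.1 •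
    ((res x (face_subset T i)).toLinearMap ∘ₗ LinearMap.proj (face T i))

theorem d_apply (x : ι → A) (q : ℕ) (ω : Cochain x q) (T : {T : Finset ι // T.card = q + 1}) :
    d x q ω T = ∑ i : T.1, (-1 : A) ^ pos T.1 i.1 •
      res x (face_subset T i) (ω (face T i)) := by
  simp only [d, LinearMap.pi_apply, LinearMap.sum_apply]
  rfl

theorem pos_erase_of_lt (T : Finset ι) {i j : ι} (h : j < i) : pos (T.erase i) j = pos T j := by
  unfold pos
  congr 1
  ext l
  simp only [Finset.mem_filter, Finset.mem_erase]
  exact ⟨fun hl => ⟨hl.1.2, hl.2⟩, fun hl => ⟨⟨(hl.2.trans h).ne, hl.1⟩, hl.2⟩⟩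

theorem pos_erase_of_gt (T : Finset ι) {i j : ι} (hi : i ∈ T) (h : i < j) :
    pos (T.erase i) j + 1 = pos T j := by
  unfold pos
  rw [Finset.filter_erase, Finset.card_erase_add_one]
  simp [hi, h]

/-- The Čech differentials form a complex. -/
theorem d_comp_d (x : ι → A) (q : ℕ) : d x (q + 1) ∘ₗ d x q = 0 := by
  ext ω T
  classical
  let g : Finset ι → Loc x T.1 := fun U =>
    if h : U ⊆ T.1 ∧ U.card = q then res x h.1 (ω ⟨U, h.2⟩) else 0
  have hg : ∀ (i : T.1) (j : (face T i).1),
      res x (face_subset T i)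
        (res x (face_subset (face T i) j) (ω (face (face T i) j))) =
      g ((T.1.erase i.1).erase j.1) := by
    intro i j
    rw [res_res]
    have h : (T.1.erase i.1).erase j.1 ⊆ T.1 ∧ ((T.1.erase i.1).erase j.1).card = q :=
      ⟨(Finset.erase_subset _ _).trans (Finset.erase_subset _ _), (face (face T i) j).2⟩
    simp only [g, dif_pos h]
    rfl
  change d x (q + 1) (d x q ω) T = 0
  rw [d_apply]
  have h1 : ∀ i : T.1, (-1 : A) ^ pos T.1 i.1 •
      res x (face_subset T i) (d x q ω (face T i)) =
      ∑ j ∈ T.1.erase i.1, (-1 : A) ^ (pos T.1 i.1 + pos (T.1.erase i.1) j) •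
        g ((T.1.erase i.1).erase j) := by
    intro i
    rw [d_apply, map_sum, Finset.smul_sum, ← Finset.sum_coe_sort (T.1.erase i.1)]
    refine Finset.sum_congr rfl fun (j : (face T i).1) _ => ?_
    rw [map_smul, hg, smul_smul, ← pow_add]
    rfl
  rw [Finset.sum_congr rfl fun i _ => h1 i,
    Finset.sum_coe_sort T.1 (fun i => ∑ j ∈ T.1.erase i,
      (-1 : A) ^ (pos T.1 i + pos (T.1.erase i) j) • g ((T.1.erase i).erase j)),
    Finset.sum_sigma']
  have key : ∀ i ∈ T.1, ∀ j ∈ T.1, i < j →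
      (-1 : A) ^ (pos T.1 i + pos (T.1.erase i) j) • g ((T.1.erase i).erase j) +
      (-1 : A) ^ (pos T.1 j + pos (T.1.erase j) i) • g ((T.1.erase j).erase i) = 0 := by
    intro i hi j hj hij
    rw [pos_erase_of_lt T.1 hij, ← pos_erase_of_gt T.1 hi hij, Finset.erase_right_comm,
      ← add_smul]
    have : (-1 : A) ^ (pos T.1 i + pos (T.1.erase i) j) +
        (-1 : A) ^ (pos (T.1.erase i) j + 1 + pos T.1 i) = 0 := by ring
    rw [this, zero_smul]
  refine Finset.sum_involution (fun a _ => ⟨a.2, a.1⟩) ?_ ?_ ?_ ?_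
  · rintro ⟨i, j⟩ h
    simp only [Finset.mem_sigma, Finset.mem_erase] at h
    rcases lt_or_gt_of_ne h.2.1 with hlt | hlt
    · exact (add_comm _ _).trans (key j h.2.2 i h.1 hlt)
    · exact key i h.1 j h.2.2 hlt
  · rintro ⟨i, j⟩ h _ he
    simp only [Finset.mem_sigma, Finset.mem_erase] at h
    exact h.2.1 (congrArg Sigma.fst he)
  · rintro ⟨i, j⟩ h
    simp only [Finset.mem_sigma, Finset.mem_erase] at h ⊢
    exact ⟨h.2.2, h.2.1.symm, h.1⟩
  · rintro ⟨i, j⟩ _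
    rfl

/-- The Čech cocycles of degree `q`. -/
abbrev cocycles (x : ι → A) (q : ℕ) : Submodule A (Cochain x q) := LinearMap.ker (d x q)

/-- The Čech coboundaries of degree `q`. -/
def coboundaries (x : ι → A) : (q : ℕ) → Submodule A (Cochain x q)
  | 0 => ⊥
  | q + 1 => LinearMap.range (d x q)

/-- The `q`-th cohomology of the Čech complex on `x`, that is, for a finite family `x` in a
Noetherian ring `A`, the local cohomology `H^q_{(x)}(A)`. -/
abbrev H (x : ι → A) (q : ℕ) : Type _ :=
  cocycles x q ⧸ (coboundaries x q).submoduleOf (cocycles x q)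

/-- Frobenius on Čech cochains: the `p`-th power map on every component. -/
def frobCochain (x : ι → A) (p : ℕ) [Fact p.Prime] (h : (p : A) = 0) (q : ℕ) :
    Cochain x q →+ Cochain x q where
  toFun ω T := frobHom p (natCast_loc x h T.1) (ω T)
  map_zero' := by funext T; simp
  map_add' a b := by funext T; simp

theorem d_frobCochain (x : ι → A) (p : ℕ) [Fact p.Prime] (h : (p : A) = 0) (q : ℕ)
    (ω : Cochain x q) : d x q (frobCochain x p h q ω) = frobCochain x p h (q + 1) (d x q ω) := by
  funext T
  have key : ∀ i : T.1, res x (face_subset T i) (frobCochain x p h q ω (face T i)) =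
      frobHom p (natCast_loc x h T.1) (res x (face_subset T i) (ω (face T i))) :=
    fun i => map_pow _ _ _
  change _ = frobHom p (natCast_loc x h T.1) (d x q ω T)
  rw [d_apply, d_apply, map_sum]
  refine Finset.sum_congr rfl fun i _ => ?_
  rw [key, Algebra.smul_def, Algebra.smul_def, map_mul]
  simp

/-- Frobenius on Čech cocycles. -/
def frobCocycles (x : ι → A) (p : ℕ) [Fact p.Prime] (h : (p : A) = 0) (q : ℕ) :
    cocycles x q →+ cocycles x q :=
  ((frobCochain x p h q).comp (cocycles x q).subtype.toAddMonoidHom).codRestrict (cocycles x q)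
    fun ω => by
      have h0 : d x q ω.1 = 0 := ω.2
      change d x q (frobCochain x p h q ω.1) = 0
      rw [d_frobCochain, h0, map_zero]

theorem frobCochain_mem_coboundaries (x : ι → A) (p : ℕ) [Fact p.Prime] (h : (p : A) = 0) (q : ℕ)
    (ω : Cochain x q) (hω : ω ∈ coboundaries x q) :
    frobCochain x p h q ω ∈ coboundaries x q := by
  cases q with
  | zero =>
    have h0 : ω = 0 := hω
    rw [h0, map_zero]
    exact Submodule.zero_mem _
  | succ q =>
    obtain ⟨η, rfl⟩ := hω
    exact ⟨frobCochain x p h q η, d_frobCochain x p h q η⟩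

/-- The Frobenius action on local cohomology: the additive map induced on Čech cohomology by the
Frobenius endomorphisms of the localizations of `A`. -/
def frob (x : ι → A) (p : ℕ) [Fact p.Prime] (h : (p : A) = 0) (q : ℕ) : H x q →+ H x q :=
  QuotientAddGroup.map _ _ (frobCocycles x p h q)
    fun ω hω => frobCochain_mem_coboundaries x p h q ω.1 hω

end Cech

/-! ### Quotients of a polynomial ring: grading on local cohomology -/

namespace CI

variable {k : Type*} [Field k] {n : ℕ}

/-- The images of the variables `x_0, …, x_n` in `k[x_0, …, x_n] / J`. -/
def vars (J : Ideal (MvPolynomial (Fin (n + 1)) k)) :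
    Fin (n + 1) → MvPolynomial (Fin (n + 1)) k ⧸ J :=
  fun i => Ideal.Quotient.mk J (MvPolynomial.X i)

/-- Local cohomology `H^q_𝔪(R)` of `R = k[x_0, …, x_n] / J`, where `𝔪` is generated by the
variables. -/
abbrev H (J : Ideal (MvPolynomial (Fin (n + 1)) k)) (q : ℕ) : Type _ := Cech.H (vars J) q

/-- The elements of degree `t ∈ ℤ` of the localization of `R = k[x_0, …, x_n] / J` at the product
`x_T` of the variables in `T`: the fractions `a / x_T ^ N` where `a` is (the class of) a form of
degree `t + N |T|`. The degree of a form is taken in `ℤ`, so that `0` is the only form of negative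
degree. -/
def locDeg (J : Ideal (MvPolynomial (Fin (n + 1)) k)) (T : Finset (Fin (n + 1))) (t : ℤ) :
    AddSubgroup (Cech.Loc (vars J) T) where
  carrier := {z | ∃ (N : ℕ) (a : MvPolynomial (Fin (n + 1)) k),
    a.IsWeightedHomogeneous (fun _ => (1 : ℤ)) (t + N * T.card) ∧
    z * algebraMap _ (Cech.Loc (vars J) T) (∏ i ∈ T, vars J i) ^ N =
      algebraMap _ (Cech.Loc (vars J) T) (Ideal.Quotient.mk J a)}
  zero_mem' := ⟨0, 0, MvPolynomial.isWeightedHomogeneous_zero _ _ _, by simp⟩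
  neg_mem' := by
    rintro z ⟨N, a, ha, h⟩
    exact ⟨N, -a, (MvPolynomial.weightedHomogeneousSubmodule k _ _).neg_mem ha, by
      rw [neg_mul, h, map_neg, map_neg]⟩
  add_mem' := by
    rintro z w ⟨N, a, ha, h⟩ ⟨M, b, hb, h'⟩
    have hX : ∀ L : ℕ, ((∏ i ∈ T, MvPolynomial.X i : MvPolynomial (Fin (n + 1)) k) ^ L
        ).IsWeightedHomogeneous (fun _ => (1 : ℤ)) (L * T.card) := by
      intro L
      have h1 := MvPolynomial.IsWeightedHomogeneous.prod T
        (fun i => (MvPolynomial.X i : MvPolynomial (Fin (n + 1)) k)) (fun _ => (1 : ℤ))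
        (w := fun _ => (1 : ℤ))
        (fun i _ => MvPolynomial.isWeightedHomogeneous_X k _ i)
      have h2 := h1.pow L
      simpa using h2
    have hm : ∀ L : ℕ, algebraMap _ (Cech.Loc (vars J) T) (∏ i ∈ T, vars J i) ^ L =
        algebraMap _ (Cech.Loc (vars J) T)
          (Ideal.Quotient.mk J ((∏ i ∈ T, MvPolynomial.X i) ^ L)) := by
      intro L
      simp [vars]
    refine ⟨N + M, a * (∏ i ∈ T, MvPolynomial.X i) ^ M + b * (∏ i ∈ T, MvPolynomial.X i) ^ N,
      ?_, ?_⟩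
    · refine MvPolynomial.IsWeightedHomogeneous.add ?_ ?_
      · convert! ha.mul (hX M) using 1
        push_cast; ring
      · convert! hb.mul (hX N) using 1
        push_cast; ring
    · rw [map_add, map_add, map_mul, map_mul, map_mul, map_mul, ← hm, ← hm, ← h, ← h', pow_add]
      ring

/-- The Čech cochains all of whose components have degree `t`. -/
def cochainDeg (J : Ideal (MvPolynomial (Fin (n + 1)) k)) (q : ℕ) (t : ℤ) :
    AddSubgroup (Cech.Cochain (vars J) q) :=
  AddSubgroup.pi Set.univ fun T => locDeg J T.1 t

/-- The graded piece `H^q_𝔪(R)_t`: the classes of the cocycles of degree `t`. -/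
def gradedPiece (J : Ideal (MvPolynomial (Fin (n + 1)) k)) (q : ℕ) (t : ℤ) :
    AddSubgroup (H J q) :=
  ((cochainDeg J q t).comap (Cech.cocycles (vars J) q).subtype.toAddMonoidHom).map
    (Submodule.mkQ _).toAddMonoidHom

/-- The part `H^q_𝔪(R)_{<0}` of negative degree: the sum of all graded pieces of degree `< 0`. -/
def negPart (J : Ideal (MvPolynomial (Fin (n + 1)) k)) (q : ℕ) : AddSubgroup (H J q) :=
  ⨆ (t : ℤ) (_ : t < 0), gradedPiece J q t

theorem natCast_quot (J : Ideal (MvPolynomial (Fin (n + 1)) k)) (p : ℕ) [CharP k p] :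
    (p : MvPolynomial (Fin (n + 1)) k ⧸ J) = 0 := by
  rw [← map_natCast (algebraMap k (MvPolynomial (Fin (n + 1)) k ⧸ J)), CharP.cast_eq_zero,
    map_zero]

/-- The Frobenius action on `H^q_𝔪(R)`. -/
def frob (J : Ideal (MvPolynomial (Fin (n + 1)) k)) (p : ℕ) [Fact p.Prime] [CharP k p] (q : ℕ) :
    H J q →+ H J q :=
  Cech.frob (vars J) p (natCast_quot J p) q

/-- The ideal of `S = k[x_0, …, x_n]` generated by the `c × c` minors of the Jacobian matrix
`(∂ f_j / ∂ x_i)`. -/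
def jacobianIdeal {c : ℕ} (f : Fin c → MvPolynomial (Fin (n + 1)) k) :
    Ideal (MvPolynomial (Fin (n + 1)) k) :=
  Ideal.span (Set.range fun r : Fin c ↪o Fin (n + 1) =>
    (Matrix.of fun a j : Fin c => MvPolynomial.pderiv (r a) (f j)).det)

end CI

end

/-!
Write `R_j = S / (f_1, …, f_j)`. Composing the connecting homomorphisms of
`0 → R_j → R_j → R_{j+1} → 0` (multiplication by `f_{j+1}`) embeds `H^{n+1-c}(R)` in
`H^{n+1}(S)`, whose elements are fractions `g / (x_0 ⋯ x_n) ^ m` modulo `(x_0 ^ m, …, x_n ^ m)`; it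
turns the Frobenius of `R` into `(∏ f_j) ^ (p - 1)` times that of `S`. So suppose that
`(∏ f_j) ^ (p - 1) * g ^ p` lies in the ideal `I = (x_0 ^ (m p), …, x_n ^ (m p))`, which every
derivation maps into itself. Applying a derivation dual to `f_j` (Cramer's rule) lowers the exponent
of `f_j` at the cost of a Jacobian minor, so descending on the exponents one only has to remove
factors in `Jac + J`: if `(Jac + J) * u ⊆ I` for `u = (∏ f_j ^ b_j) * g ^ p`, then `u ∈ I`.
Since `√(Jac + J)` contains `𝔪`, over the algebraic closure the `f_j` extend to a regular sequence
of `n + 1` forms in `Jac + J`. Reversing the connecting homomorphisms, the class of `u`, which is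
killed by this sequence, comes from the quotient by it, and the bound on `p` makes the degree there
negative, where that quotient vanishes.
-/

noncomputable section

namespace Cech

/-! ### Localizations -/

section Localization

variable {A : Type*} [CommRing A] {ι : Type*} (x : ι → A) (T : Finset ι)

theorem isUnit_algebraMap_prod_pow (N : ℕ) :
    IsUnit (algebraMap A (Loc x T) (∏ i ∈ T, x i) ^ N) :=
  (isUnit_prod x (Finset.Subset.refl T)).pow N

theorem exists_mul_prod_pow_eq (N : ℕ) (a : A) :
    ∃ z : Loc x T, z * algebraMap A _ (∏ i ∈ T, x i) ^ N = algebraMap A _ a :=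
  (isUnit_algebraMap_prod_pow x T N).dvd.imp fun z hz => (mul_comm z _).trans hz.symm

theorem exists_forall_ge_mul_prod_pow_eq (z : Loc x T) : ∃ N₀ : ℕ, ∀ N ≥ N₀, ∃ a : A,
    z * algebraMap A _ (∏ i ∈ T, x i) ^ N = algebraMap A _ a := by
  obtain ⟨N₀, a, h⟩ := IsLocalization.Away.surj (∏ i ∈ T, x i) z
  refine ⟨N₀, fun N hN => ⟨a * (∏ i ∈ T, x i) ^ (N - N₀), ?_⟩⟩
  rw [map_mul, ← h, map_pow, mul_assoc, ← pow_add, Nat.add_sub_cancel' hN]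

theorem exists_mul_prod_pow_eq_algebraMap (z : Loc x T) :
    ∃ (N : ℕ) (a : A), z * algebraMap A _ (∏ i ∈ T, x i) ^ N = algebraMap A _ a :=
  (exists_forall_ge_mul_prod_pow_eq x T z).imp fun N h => h N le_rfl

theorem algebraMap_loc_eq_zero_iff (a : A) :
    algebraMap A (Loc x T) a = 0 ↔ ∃ N : ℕ, (∏ i ∈ T, x i) ^ N * a = 0 := by
  rw [IsLocalization.map_eq_zero_iff (Submonoid.powers (∏ i ∈ T, x i))]
  exact ⟨by rintro ⟨⟨_, N, rfl⟩, h⟩; exact ⟨N, h⟩, fun ⟨N, h⟩ => ⟨⟨_, N, rfl⟩, h⟩⟩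

variable {x T}

theorem smul_loc_eq_zero {h : A} (hh : h ∈ nonZeroDivisors A) {z : Loc x T} (hz : h • z = 0) :
    z = 0 := by
  rw [Algebra.smul_def, mul_comm] at hz
  exact (mul_right_mem_nonZeroDivisors_eq_zero_iff <| IsLocalization.map_nonZeroDivisors_le
    (Submonoid.powers (∏ i ∈ T, x i)) _ (Submonoid.mem_map_of_mem _ hh)).1 hz

theorem smul_mul_eq_algebraMap {a b : A} {z u : Loc x T} (h : z * u = algebraMap A _ b) :
    a • z * u = algebraMap A _ (a * b) := by
  rw [smul_mul_assoc, h, Algebra.smul_def, map_mul]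

theorem res_mul_prod_pow_eq [DecidableEq ι] {U : Finset ι} (hTU : T ⊆ U) {N : ℕ} {a : A}
    {z : Loc x T} (hz : z * algebraMap A _ (∏ i ∈ T, x i) ^ N = algebraMap A _ a) :
    res x hTU z * algebraMap A _ (∏ i ∈ U, x i) ^ N =
      algebraMap A _ (a * (∏ i ∈ U \ T, x i) ^ N) := by
  have hU : algebraMap A (Loc x U) (∏ i ∈ U, x i) =
      algebraMap A _ (∏ i ∈ T, x i) * algebraMap A _ (∏ i ∈ U \ T, x i) := by
    rw [← map_mul, mul_comm, Finset.prod_sdiff hTU]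
  rw [map_mul, ← (res x hTU).commutes a, ← hz, map_mul, map_pow, map_pow, AlgHom.commutes, hU]
  ring

theorem res_injective {U : Finset ι} (hTU : T ⊆ U) (hx : ∀ i ∈ U, i ∉ T → x i ∈ nonZeroDivisors A) :
    Function.Injective (res x hTU) := by
  classical
  refine (injective_iff_map_eq_zero _).2 fun z hz => ?_
  obtain ⟨N, a, ha⟩ := exists_mul_prod_pow_eq_algebraMap x T z
  have h0 : algebraMap A (Loc x U) a = 0 := by
    rw [← (res x hTU).commutes, ← ha, map_mul, hz, zero_mul]
  obtain ⟨M, hM⟩ := (algebraMap_loc_eq_zero_iff x U a).1 h0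
  have hUT : (∏ i ∈ U \ T, x i) ^ M ∈ nonZeroDivisors A :=
    pow_mem (prod_mem fun i hi => (Finset.mem_sdiff.1 hi).elim (hx i)) M
  rw [← Finset.prod_sdiff hTU, mul_pow, mul_assoc,
    mul_left_mem_nonZeroDivisors_eq_zero_iff hUT] at hM
  rw [(algebraMap_loc_eq_zero_iff x T a).2 ⟨M, hM⟩] at ha
  exact (isUnit_algebraMap_prod_pow x T N).mul_left_eq_zero.1 ha

end Localization

/-! ### Functoriality of the Čech complex -/

section Functoriality

variable {A : Type*} [CommRing A] {ι : Type*} {B : Type*} [CommRing B] {π : A →+* B} {x : ι → A}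
  {y : ι → B} (hxy : ∀ i, π (x i) = y i)

/-- The map `A_{x_T} → B_{y_T}` induced by a ring homomorphism `A → B` which maps each `x i` to
`y i`. -/
def locMap (T : Finset ι) : Loc x T →+* Loc y T :=
  IsLocalization.Away.lift (∏ i ∈ T, x i) (g := (algebraMap B (Loc y T)).comp π) <| by
    simpa [hxy] using isUnit_algebraMap_prod_pow y T 1

theorem locMap_algebraMap (T : Finset ι) (a : A) :
    locMap hxy T (algebraMap A _ a) = algebraMap B _ (π a) :=
  IsLocalization.Away.lift_eq _ _ a

theorem locMap_prod_pow (T : Finset ι) (N : ℕ) :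
    locMap hxy T (algebraMap A _ (∏ i ∈ T, x i) ^ N) = algebraMap B _ (∏ i ∈ T, y i) ^ N := by
  rw [map_pow, locMap_algebraMap, map_prod π]
  simp only [hxy]

theorem locMap_mul_prod_pow_eq {T : Finset ι} {N : ℕ} {a : A} {z : Loc x T}
    (hz : z * algebraMap A _ (∏ i ∈ T, x i) ^ N = algebraMap A _ a) :
    locMap hxy T z * algebraMap B _ (∏ i ∈ T, y i) ^ N = algebraMap B _ (π a) := by
  rw [← locMap_prod_pow hxy, ← map_mul, hz, locMap_algebraMap]

theorem locMap_smul (T : Finset ι) (a : A) (z : Loc x T) :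
    locMap hxy T (a • z) = π a • locMap hxy T z := by
  rw [Algebra.smul_def, map_mul, locMap_algebraMap, Algebra.smul_def]

theorem locMap_res {T U : Finset ι} (h : T ⊆ U) (z : Loc x T) :
    locMap hxy U (res x h z) = res y h (locMap hxy T z) := by
  have : (locMap hxy U).comp (res x h).toRingHom = (res y h).toRingHom.comp (locMap hxy T) := by
    refine IsLocalization.ringHom_ext (Submonoid.powers (∏ i ∈ T, x i)) (RingHom.ext fun a => ?_)
    simp [locMap_algebraMap]
  exact DFunLike.congr_fun this z

/-- The map induced on Čech cochains by a ring homomorphism which maps each `x i` to `y i`. -/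
def cochainMap (q : ℕ) : Cochain x q →+ Cochain y q where
  toFun ω T := locMap hxy T.1 (ω T)
  map_zero' := by funext T; simp
  map_add' a b := by funext T; simp

theorem cochainMap_apply {q : ℕ} (ω : Cochain x q) (T : {T : Finset ι // T.card = q}) :
    cochainMap hxy q ω T = locMap hxy T.1 (ω T) := rfl

theorem cochainMap_smul {q : ℕ} (a : A) (ω : Cochain x q) :
    cochainMap hxy q (a • ω) = π a • cochainMap hxy q ω :=
  funext fun T => locMap_smul hxy T.1 a (ω T)

theorem mul_smul_cochain {q : ℕ} (a b : A) (ω : Cochain x q) : (a * b) • ω = a • b • ω :=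
  mul_smul a b ω

theorem smul_cochain_injective {h : A} (hh : h ∈ nonZeroDivisors A) (q : ℕ) :
    Function.Injective fun ω : Cochain x q => h • ω := fun ω η hωη =>
  sub_eq_zero.1 <| funext fun T => smul_loc_eq_zero hh <| by
    simpa [smul_sub, sub_eq_zero] using congrFun hωη T

/-- A presentation `B ≅ A / (h)` with `h` a nonzerodivisor of `A`. -/
structure IsHypersurfaceQuotient (π : A →+* B) (h : A) : Prop where
  surjective : Function.Surjective π
  ker_eq : RingHom.ker π = Ideal.span {h}
  mem_nonZeroDivisors : h ∈ nonZeroDivisors A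

namespace IsHypersurfaceQuotient

variable {h : A} (hπ : IsHypersurfaceQuotient π h)

include hπ

theorem map_eq_zero_iff {a : A} : π a = 0 ↔ h ∣ a := by
  rw [← RingHom.mem_ker, hπ.ker_eq, Ideal.mem_span_singleton]

theorem map_eq_zero : π h = 0 := hπ.map_eq_zero_iff.2 dvd_rfl

theorem locMap_surjective (T : Finset ι) : Function.Surjective (locMap hxy T) := by
  intro w
  obtain ⟨N, b, hb⟩ := exists_mul_prod_pow_eq_algebraMap y T w
  obtain ⟨a, rfl⟩ := hπ.surjective b
  obtain ⟨z, hz⟩ := exists_mul_prod_pow_eq x T N a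
  refine ⟨z, (isUnit_algebraMap_prod_pow y T N).mul_right_cancel ?_⟩
  rw [hb, locMap_mul_prod_pow_eq hxy hz]

theorem exists_smul_eq_of_locMap_eq_zero {T : Finset ι} {z : Loc x T} (hz : locMap hxy T z = 0) :
    ∃ w, h • w = z := by
  obtain ⟨N, a, ha⟩ := exists_mul_prod_pow_eq_algebraMap x T z
  have h0 : algebraMap B (Loc y T) (π a) = 0 := by
    rw [← locMap_algebraMap hxy, ← ha, map_mul, hz, zero_mul]
  obtain ⟨M, hM⟩ := (algebraMap_loc_eq_zero_iff y T _).1 h0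
  simp only [← hxy, ← map_prod, ← map_pow, ← map_mul] at hM
  obtain ⟨b, hb⟩ := hπ.map_eq_zero_iff.1 hM
  obtain ⟨w, hw⟩ := exists_mul_prod_pow_eq x T (M + N) b
  refine ⟨w, (isUnit_algebraMap_prod_pow x T (M + N)).mul_right_cancel ?_⟩
  rw [smul_mul_assoc, hw, Algebra.smul_def, ← map_mul, ← hb, map_mul, ← ha, map_pow, pow_add]
  ring

theorem cochainMap_surjective (q : ℕ) : Function.Surjective (cochainMap hxy q) := by
  intro ω
  choose η hη using fun T : {T : Finset ι // T.card = q} => hπ.locMap_surjective hxy T.1 (ω T)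
  exact ⟨η, funext fun T => hη T⟩

theorem exists_smul_eq_of_cochainMap_eq_zero {q : ℕ} {ω : Cochain x q}
    (hω : cochainMap hxy q ω = 0) : ∃ η, h • η = ω := by
  choose η hη using fun T => hπ.exists_smul_eq_of_locMap_eq_zero hxy (congrFun hω T)
  exact ⟨η, funext hη⟩

end IsHypersurfaceQuotient

theorem cochainMap_frobCochain {p : ℕ} [Fact p.Prime] (hA : (p : A) = 0) (hB : (p : B) = 0)
    {q : ℕ} (ω : Cochain x q) :
    cochainMap hxy q (frobCochain x p hA q ω) = frobCochain y p hB q (cochainMap hxy q ω) :=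
  funext fun T => map_pow (locMap hxy T.1) (ω T) p

theorem frobCochain_smul {p : ℕ} [Fact p.Prime] (hA : (p : A) = 0) {q : ℕ} (a : A)
    (ω : Cochain x q) : frobCochain x p hA q (a • ω) = a ^ p • frobCochain x p hA q ω :=
  funext fun T => smul_pow a (ω T) p

variable [LinearOrder ι]

theorem cochainMap_d {q : ℕ} (ω : Cochain x q) :
    cochainMap hxy (q + 1) (d x q ω) = d y q (cochainMap hxy q ω) := by
  funext T
  rw [cochainMap_apply, d_apply, d_apply, map_sum]
  refine Finset.sum_congr rfl fun i _ => ?_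
  rw [locMap_smul, locMap_res, map_pow, map_neg, map_one, cochainMap_apply]

theorem d_apply_mem {q : ℕ} {ω : Cochain x q} {T : {T : Finset ι // T.card = q + 1}}
    {G : AddSubgroup (Loc x T.1)} (h : ∀ i, res x (face_subset T i) (ω (face T i)) ∈ G) :
    d x q ω T ∈ G := by
  rw [d_apply]
  refine sum_mem fun i _ => ?_
  rcases neg_one_pow_eq_or A (pos T.1 i.1) with hi | hi
  · simpa only [hi, one_smul] using h i
  · simpa only [hi, neg_smul, one_smul] using neg_mem (h i)

theorem d_d {q : ℕ} (ω : Cochain x q) : d x (q + 1) (d x q ω) = 0 :=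
  DFunLike.congr_fun (d_comp_d x q) ω

theorem d_eq_zero_of_mem_coboundaries {q : ℕ} {ω : Cochain x q} (h : ω ∈ coboundaries x q) :
    d x q ω = 0 := by
  cases q with
  | zero => rw [(Submodule.mem_bot A).1 h, map_zero]
  | succ q =>
    obtain ⟨η, rfl⟩ := h
    exact d_d η

theorem cochainMap_mem_coboundaries {q : ℕ} {ω : Cochain x q} (h : ω ∈ coboundaries x q) :
    cochainMap hxy q ω ∈ coboundaries y q := by
  cases q with
  | zero =>
    rw [(Submodule.mem_bot A).1 h, map_zero]
    exact zero_mem _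
  | succ q =>
    obtain ⟨η, rfl⟩ := h
    exact ⟨cochainMap hxy q η, (cochainMap_d hxy η).symm⟩

theorem d_frobCochain_of_d_eq_smul {p : ℕ} [hp : Fact p.Prime] (hA : (p : A) = 0) {h : A} {q : ℕ}
    {ω : Cochain x q} {η : Cochain x (q + 1)} (hω : d x q ω = h • η) :
    d x q (frobCochain x p hA q ω) = h • h ^ (p - 1) • frobCochain x p hA (q + 1) η := by
  rw [d_frobCochain, hω, frobCochain_smul, smul_smul, ← pow_succ', Nat.sub_add_cancel hp.out.one_le]

end Functoriality

/-! ### Long exact sequences -/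

section Vanishing

variable {A : Type*} [CommRing A] {ι : Type*} [LinearOrder ι] {B : Type*} [CommRing B]
  {π : A →+* B} {x : ι → A} {y : ι → B} {h : A}

/-- Vanishing of the `q`-th Čech cohomology. -/
def Vanishes (x : ι → A) (q : ℕ) : Prop := cocycles x q ≤ coboundaries x q

namespace IsHypersurfaceQuotient

variable (hπ : IsHypersurfaceQuotient π h) (hxy : ∀ i, π (x i) = y i)

include hπ

theorem exists_mem_coboundaries_cochainMap_eq {q : ℕ} {ω : Cochain y q}
    (hω : ω ∈ coboundaries y q) : ∃ β ∈ coboundaries x q, cochainMap hxy q β = ω := by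
  cases q with
  | zero => exact ⟨0, zero_mem _, by rw [(Submodule.mem_bot B).1 hω, map_zero]⟩
  | succ q =>
    obtain ⟨η, rfl⟩ := hω
    obtain ⟨μ, rfl⟩ := hπ.cochainMap_surjective hxy q η
    exact ⟨d x q μ, ⟨μ, rfl⟩, cochainMap_d hxy μ⟩

theorem mem_coboundaries_of_cochainMap_mem {q : ℕ} {ω : Cochain x q} {η : Cochain x (q + 1)}
    (hη : d x q ω = h • η) (hω : cochainMap hxy q ω ∈ coboundaries y q) :
    η ∈ coboundaries x (q + 1) := by
  obtain ⟨β, hβ, hβω⟩ := hπ.exists_mem_coboundaries_cochainMap_eq hxy hω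
  obtain ⟨μ, hμ⟩ := hπ.exists_smul_eq_of_cochainMap_eq_zero hxy (ω := ω - β)
    (by rw [map_sub, hβω, sub_self])
  refine ⟨μ, smul_cochain_injective hπ.mem_nonZeroDivisors _ ?_⟩
  change h • d x q μ = h • η
  rw [← map_smul, hμ, map_sub, d_eq_zero_of_mem_coboundaries hβ, sub_zero, hη]

/-- The connecting homomorphism `H^q(A / h) → H^{q+1}(A)` is injective if `H^q(A) = 0`. -/
theorem cochainMap_mem_coboundaries_iff {q : ℕ} (hv : Vanishes x q) {ω : Cochain x q}
    {η : Cochain x (q + 1)} (hη : d x q ω = h • η) :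
    cochainMap hxy q ω ∈ coboundaries y q ↔ η ∈ coboundaries x (q + 1) := by
  refine ⟨hπ.mem_coboundaries_of_cochainMap_mem hxy hη, ?_⟩
  rintro ⟨μ, rfl⟩
  have h0 : d x q (ω - h • μ) = 0 := by rw [map_sub, hη, map_smul, sub_self]
  simpa [cochainMap_smul, hπ.map_eq_zero] using cochainMap_mem_coboundaries hxy (hv h0)

theorem exists_d_eq_smul {q : ℕ} {ω : Cochain x q} (hω : d y q (cochainMap hxy q ω) = 0) :
    ∃ η, d x q ω = h • η ∧ d x (q + 1) η = 0 := by
  rw [← cochainMap_d] at hω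
  obtain ⟨η, hη⟩ := hπ.exists_smul_eq_of_cochainMap_eq_zero hxy hω
  refine ⟨η, hη.symm, smul_cochain_injective hπ.mem_nonZeroDivisors _ ?_⟩
  change h • d x (q + 1) η = h • 0
  rw [← map_smul, hη, d_d, smul_zero]

include hxy

theorem vanishes {q : ℕ} (hv : Vanishes x q) (hv' : Vanishes x (q + 1)) : Vanishes y q := by
  intro ω hω
  obtain ⟨ω, rfl⟩ := hπ.cochainMap_surjective hxy q ω
  obtain ⟨η, hη, hdη⟩ := hπ.exists_d_eq_smul hxy hω
  exact (hπ.cochainMap_mem_coboundaries_iff hxy hv hη).2 (hv' hdη)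

/-- Multiplication by `h` is injective on `H^q(A)` if `H^{q-1}(A / h) = 0`. -/
theorem mem_coboundaries_of_smul_mem {q : ℕ} (hv : ∀ r, r + 1 = q → Vanishes y r)
    {ω : Cochain x q} (hω : h • ω ∈ coboundaries x q) : ω ∈ coboundaries x q := by
  cases q with
  | zero =>
    exact smul_cochain_injective hπ.mem_nonZeroDivisors 0
      (((Submodule.mem_bot A).1 hω).trans (smul_zero h).symm)
  | succ q =>
    obtain ⟨ν, hν⟩ := hω
    refine hπ.mem_coboundaries_of_cochainMap_mem hxy hν (hv q rfl ?_)
    rw [LinearMap.mem_ker, ← cochainMap_d, hν, cochainMap_smul, hπ.map_eq_zero, zero_smul]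

end IsHypersurfaceQuotient

theorem Vanishes.eq_zero_of_forall_mul_eq_zero {x : ι → A} (hv : Vanishes x 0) {a : A}
    (ha : ∀ i, x i * a = 0) : a = 0 := by
  have hd : d x 0 (fun T => algebraMap A (Loc x T.1) a) = 0 := by
    funext T
    rw [d_apply]
    refine Finset.sum_eq_zero fun i _ => ?_
    have hi : algebraMap A (Loc x T.1) a = 0 := (algebraMap_loc_eq_zero_iff x T.1 a).2
      ⟨1, by rw [pow_one, ← Finset.prod_erase_mul _ _ i.2, mul_assoc, ha, mul_zero]⟩
    rw [AlgHom.commutes, hi, smul_zero]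
  obtain ⟨N, hN⟩ := (algebraMap_loc_eq_zero_iff x ∅ a).1
    (congrFun ((Submodule.mem_bot A).1 (hv hd)) ⟨∅, Finset.card_empty⟩)
  simpa using hN

end Vanishing

/-! ### Torsion -/

section Torsion

variable {A : Type*} [CommRing A] {ι : Type*} [LinearOrder ι] {x : ι → A} {i : ι} {q : ℕ}

theorem d_apply_of_forall_mem_eq_zero {ω : Cochain x q} (hω : ∀ U, i ∈ U.1 → ω U = 0)
    (T : {T : Finset ι // T.card = q + 1}) (hi : i ∈ T.1) :
    d x q ω T = (-1 : A) ^ pos T.1 i • res x (face_subset T ⟨i, hi⟩) (ω (face T ⟨i, hi⟩)) := by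
  rw [d_apply, Finset.sum_eq_single_of_mem ⟨i, hi⟩ (Finset.mem_univ _)]
  intro j _ hj
  have hij : i ∈ (face T j).1 := Finset.mem_erase.2 ⟨fun h => hj (Subtype.ext h.symm), hi⟩
  rw [hω _ hij, map_zero, smul_zero]

theorem eq_zero_of_d_eq_zero_of_forall_mem_eq_zero (hx : x i ∈ nonZeroDivisors A)
    {ω : Cochain x q} (hω : ∀ U, i ∈ U.1 → ω U = 0) (hd : d x q ω = 0) : ω = 0 := by
  funext T
  by_cases hi : i ∈ T.1
  · exact hω T hi
  let V : {V : Finset ι // V.card = q + 1} :=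
    ⟨insert i T.1, by rw [Finset.card_insert_of_notMem hi, T.2]⟩
  have hV : i ∈ V.1 := Finset.mem_insert_self i T.1
  have hface : face V ⟨i, hV⟩ = T := Subtype.ext (Finset.erase_insert hi)
  have hres : Function.Injective (res x (face_subset V ⟨i, hV⟩)) := by
    refine res_injective _ fun j hj hjT => ?_
    rw [hface] at hjT
    rwa [(Finset.mem_insert.1 hj).resolve_right hjT]
  have h0 := congrFun hd V
  rw [d_apply_of_forall_mem_eq_zero hω V hV, Pi.zero_apply, (isUnit_one.neg.pow _).smul_eq_zero,
    (map_eq_zero_iff _ hres)] at h0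
  exact hface ▸ h0

theorem prod_pow_eq_prod_erase_pow_mul {T : Finset ι} (hi : i ∈ T) (N : ℕ) :
    algebraMap A (Loc x T) (∏ j ∈ T, x j) ^ N =
      algebraMap A _ (∏ j ∈ T.erase i, x j) ^ N * algebraMap A _ (x i ^ N) := by
  rw [← map_pow, ← map_pow, ← map_mul, ← mul_pow, Finset.prod_erase_mul T x hi]

theorem res_mul_prod_pow {T : Finset ι} (hi : i ∈ T) {N : ℕ} {a : A} {w : Loc x (T.erase i)}
    (hw : w * algebraMap A _ (∏ j ∈ T.erase i, x j) ^ N = algebraMap A _ a) :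
    res x (T.erase_subset i) w * algebraMap A _ (∏ j ∈ T, x j) ^ N =
      algebraMap A _ (a * x i ^ N) := by
  have hres := congrArg (res x (T.erase_subset i)) hw
  rw [map_mul, map_pow, AlgHom.commutes, AlgHom.commutes] at hres
  rw [prod_pow_eq_prod_erase_pow_mul hi, ← mul_assoc, hres, map_mul]

theorem exists_forall_ge_res_eq_pow_smul {T : Finset ι} (hi : i ∈ T) (z : Loc x T) :
    ∃ M₀ : ℕ, ∀ M ≥ M₀, ∃ w : Loc x (T.erase i), res x (T.erase_subset i) w = x i ^ M • z := by
  obtain ⟨N, a, ha⟩ := exists_mul_prod_pow_eq_algebraMap x T z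
  refine ⟨N, fun M hM => ?_⟩
  obtain ⟨w, hw⟩ := exists_mul_prod_pow_eq x (T.erase i) N (x i ^ (M - N) * a)
  refine ⟨w, (isUnit_algebraMap_prod_pow x T N).mul_right_cancel ?_⟩
  rw [res_mul_prod_pow hi hw, smul_mul_assoc, ha, Algebra.smul_def, ← map_mul, mul_right_comm,
    ← pow_add, Nat.sub_add_cancel hM]

theorem exists_d_apply_eq_pow_smul [Finite ι] (ω : Cochain x (q + 1)) :
    ∃ (M : ℕ) (η : Cochain x q), ∀ T, i ∈ T.1 → d x q η T = x i ^ M • ω T := by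
  have hlift (T : {T : Finset ι // T.card = q + 1}) (hi : i ∈ T.1) :=
    exists_forall_ge_res_eq_pow_smul hi ((-1 : A) ^ pos T.1 i • ω T)
  choose! M₀ hM₀ using hlift
  obtain ⟨M, hM⟩ := (Set.finite_range M₀).bddAbove
  have hcomp (U : {U : Finset ι // U.card = q}) : ∃ w : Loc x U.1, (i ∈ U.1 → w = 0) ∧
      ∀ T (hi : i ∈ T.1), face T ⟨i, hi⟩ = U → ∀ hUT : U.1 ⊆ T.1,
        res x hUT w = x i ^ M • (-1 : A) ^ pos T.1 i • ω T := by
    by_cases hU : ∃ T, ∃ hi : i ∈ T.1, face T ⟨i, hi⟩ = U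
    · obtain ⟨T, hi, rfl⟩ := hU
      obtain ⟨w, hw⟩ := hM₀ T hi M (hM ⟨T, rfl⟩)
      refine ⟨w, fun h => (Finset.notMem_erase i T.1 h).elim, fun T' hi' hT' _ => ?_⟩
      obtain rfl : T' = T := by
        rw [Subtype.ext_iff, ← Finset.insert_erase hi', ← Finset.insert_erase hi]
        exact congrArg (insert i ·.1) hT'
      exact hw
    · exact ⟨0, fun _ => rfl, fun T hi h => (hU ⟨T, hi, h⟩).elim⟩
  choose η hη0 hη using hcomp
  refine ⟨M, η, fun T hi => ?_⟩
  rw [d_apply_of_forall_mem_eq_zero hη0 T hi, hη _ T hi rfl, smul_comm _ (x i ^ M)]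
  simp only [smul_smul, ← mul_pow, neg_mul_neg, one_mul, one_pow, one_smul]

theorem exists_pow_smul_mem_coboundaries [Finite ι] (hx : x i ∈ nonZeroDivisors A)
    {ω : Cochain x q} (hω : d x q ω = 0) : ∃ M : ℕ, x i ^ M • ω ∈ coboundaries x q := by
  cases q with
  | zero =>
    refine ⟨0, ?_⟩
    rw [eq_zero_of_d_eq_zero_of_forall_mem_eq_zero (i := i) hx (fun U hU => ?_) hω, smul_zero]
    · exact zero_mem _
    · rw [Finset.card_eq_zero.1 U.2] at hU
      exact (Finset.notMem_empty i hU).elim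
  | succ q =>
    obtain ⟨M, η, hη⟩ := exists_d_apply_eq_pow_smul (i := i) ω
    refine ⟨M, η, sub_eq_zero.1 <| eq_zero_of_d_eq_zero_of_forall_mem_eq_zero hx
      (fun T hi => sub_eq_zero.2 (hη T hi)) ?_⟩
    rw [map_sub, d_d, map_smul, hω, smul_zero, sub_zero]

theorem IsHypersurfaceQuotient.vanishes_of_vanishes [Finite ι] {B : Type*} [CommRing B]
    {π : A →+* B} {y : ι → B} (hπ : IsHypersurfaceQuotient π (x i)) (hxy : ∀ j, π (x j) = y j)
    (hv : ∀ r, r + 1 = q → Vanishes y r) : Vanishes x q := by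
  intro ω hω
  obtain ⟨M, hM⟩ := exists_pow_smul_mem_coboundaries hπ.mem_nonZeroDivisors hω
  induction M with
  | zero => simpa using hM
  | succ M ih =>
    rw [pow_succ', mul_smul] at hM
    exact ih (hπ.mem_coboundaries_of_smul_mem hxy hv hM)

end Torsion

/-! ### Top cohomology -/

section Top

variable {A : Type*} [CommRing A] {ι : Type*} [LinearOrder ι] {x : ι → A} {q : ℕ}
  (T : {T : Finset ι // T.card = q + 1})

theorem d_apply_mul_prod_pow {M : ℕ} {ω : Cochain x q} {a : ι → A}
    (ha : ∀ i : T.1, ω (face T i) * algebraMap A _ (∏ j ∈ T.1.erase i.1, x j) ^ M =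
      algebraMap A _ (a i.1)) :
    d x q ω T * algebraMap A _ (∏ j ∈ T.1, x j) ^ M =
      algebraMap A _ (∑ i ∈ T.1, (-1) ^ pos T.1 i * a i * x i ^ M) := by
  rw [d_apply, Finset.sum_mul, map_sum, ← Finset.sum_coe_sort T.1]
  refine Finset.sum_congr rfl fun i _ => ?_
  rw [smul_mul_assoc, mul_assoc, map_mul, ← Algebra.smul_def]
  exact congrArg _ (res_mul_prod_pow i.2 (ha i))

theorem face_injective : Function.Injective (face T) := fun i j h =>
  Subtype.ext (Finset.erase_injOn T.1 i.2 j.2 (congrArg Subtype.val h))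

theorem exists_cochain_mul_prod_pow_eq (M : ℕ) (a : ι → A) :
    ∃ ω : Cochain x q, ∀ i : T.1,
      ω (face T i) * algebraMap A _ (∏ j ∈ T.1.erase i.1, x j) ^ M = algebraMap A _ (a i.1) := by
  have hcomp (U : {U : Finset ι // U.card = q}) : ∃ w : Loc x U.1, ∀ i : T.1, face T i = U →
      w * algebraMap A _ (∏ j ∈ U.1, x j) ^ M = algebraMap A _ (a i.1) := by
    by_cases hU : ∃ i, face T i = U
    · obtain ⟨i, rfl⟩ := hU
      obtain ⟨w, hw⟩ := exists_mul_prod_pow_eq x (face T i).1 M (a i.1)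
      exact ⟨w, fun j hj => face_injective T hj ▸ hw⟩
    · exact ⟨0, fun i hi => (hU ⟨i, hi⟩).elim⟩
  choose ω hω using hcomp
  exact ⟨ω, fun i => hω _ i rfl⟩

theorem exists_common_denominator (ω : Cochain x q) : ∃ (M : ℕ) (a : ι → A), ∀ i : T.1,
    ω (face T i) * algebraMap A _ (∏ j ∈ T.1.erase i.1, x j) ^ M = algebraMap A _ (a i.1) := by
  choose N₀ hN₀ using fun i : T.1 => exists_forall_ge_mul_prod_pow_eq x _ (ω (face T i))
  obtain ⟨M, hM⟩ := (Set.finite_range N₀).bddAbove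
  choose a ha using fun i : T.1 => hN₀ i M (hM ⟨i, rfl⟩)
  refine ⟨M, fun i => if hi : i ∈ T.1 then a ⟨i, hi⟩ else 0, fun i => ?_⟩
  simp only [i.2, dite_true]
  exact ha i

variable {T} [Fintype ι]

omit [LinearOrder ι] in
theorem eq_of_val_eq_univ (hT : T.1 = Finset.univ) (U : {U : Finset ι // U.card = q + 1}) :
    U = T :=
  Subtype.ext (Finset.eq_of_subset_of_card_le (hT ▸ Finset.subset_univ _) (by rw [T.2, U.2]))

omit [LinearOrder ι] in
theorem eq_of_apply_mul_prod_pow_eq (hT : T.1 = Finset.univ) {η ν : Cochain x (q + 1)} {M : ℕ}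
    (h : η T * algebraMap A _ (∏ i ∈ T.1, x i) ^ M = ν T * algebraMap A _ (∏ i ∈ T.1, x i) ^ M) :
    η = ν := by
  funext U
  obtain rfl := eq_of_val_eq_univ hT U
  exact (isUnit_algebraMap_prod_pow x U.1 M).mul_right_cancel h

/-- `H^{q+1}_{(x)}(A)`, for `x` of length `q + 1`, is the direct limit of the quotients
`A / (x_i ^ m)` along multiplication by the product of the `x_i`. -/
theorem mem_coboundaries_top_iff (hT : T.1 = Finset.univ) {η : Cochain x (q + 1)} {m : ℕ} {a : A}
    (ha : η T * algebraMap A _ (∏ i ∈ T.1, x i) ^ m = algebraMap A _ a) :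
    η ∈ coboundaries x (q + 1) ↔
      ∃ M, (∏ i, x i) ^ M * a ∈ Ideal.span (Set.range fun i => x i ^ (m + M)) := by
  constructor
  · rintro ⟨ω, rfl⟩
    obtain ⟨M, b, hb⟩ := exists_common_denominator T ω
    have hd := d_apply_mul_prod_pow T hb
    have hab : algebraMap A (Loc x T.1) ((∏ i ∈ T.1, x i) ^ M * a - (∏ i ∈ T.1, x i) ^ m *
        ∑ i ∈ T.1, (-1) ^ pos T.1 i * b i * x i ^ M) = 0 := by
      rw [map_sub, map_mul, map_mul, ← ha, ← hd, map_pow, map_pow]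
      ring
    obtain ⟨L, hL⟩ := (algebraMap_loc_eq_zero_iff x T.1 _).1 hab
    refine ⟨L + M, ?_⟩
    rw [hT, mul_sub, sub_eq_zero, ← mul_assoc, ← pow_add] at hL
    rw [hL, ← mul_assoc, ← pow_add, Finset.mul_sum]
    refine sum_mem fun i _ => ?_
    have hpow : x i ^ (m + (L + M)) ∣ (∏ j, x j) ^ (L + m) * x i ^ M := by
      rw [add_left_comm, ← add_assoc, pow_add]
      gcongr
      exact Finset.dvd_prod_of_mem x (Finset.mem_univ i)
    rw [mul_left_comm]
    exact Ideal.mul_mem_left _ _ (Ideal.mem_of_dvd _ hpow (Ideal.subset_span ⟨i, rfl⟩))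
  · rintro ⟨M, hM⟩
    obtain ⟨c, hc⟩ := Ideal.mem_span_range_iff_exists_fun.1 hM
    obtain ⟨ω, hω⟩ := exists_cochain_mul_prod_pow_eq (x := x) T (m + M)
      fun i => (-1) ^ pos T.1 i * c i
    refine ⟨ω, eq_of_apply_mul_prod_pow_eq hT (M := m + M) ?_⟩
    rw [d_apply_mul_prod_pow T (a := fun i => (-1) ^ pos T.1 i * c i) hω, pow_add, ← mul_assoc,
      ha, ← map_pow, ← map_mul, mul_comm a, hT, ← hc]
    simp only [← mul_assoc, ← mul_pow, neg_mul_neg, one_mul, one_pow]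

end Top

/-! ### Polynomial rings -/

theorem IsHypersurfaceQuotient.factor {S : Type*} [CommRing S] {J : Ideal S} {h : S}
    (hh : Ideal.Quotient.mk J h ∈ nonZeroDivisors (S ⧸ J)) :
    IsHypersurfaceQuotient (Ideal.Quotient.factor (le_sup_left : J ≤ J ⊔ Ideal.span {h}))
      (Ideal.Quotient.mk J h) where
  surjective := Ideal.Quotient.factor_surjective _
  ker_eq := by
    rw [Ideal.Quotient.factor_ker, Ideal.map_sup, Ideal.map_quotient_self, bot_sup_eq,
      Ideal.map_span, Set.image_singleton]
  mem_nonZeroDivisors := hh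

theorem mk_mem_nonZeroDivisors_iff {S : Type*} [CommRing S] {J : Ideal S} {h : S} :
    Ideal.Quotient.mk J h ∈ nonZeroDivisors (S ⧸ J) ↔ ∀ a, h * a ∈ J → a ∈ J := by
  rw [mem_nonZeroDivisors_iff_right, Ideal.Quotient.mk_surjective.forall]
  simp only [← map_mul, Ideal.Quotient.eq_zero_iff_mem, mul_comm]

variable {R : Type*} [CommRing R] {σ : Type*}

theorem mk_X_mem_nonZeroDivisors {T : Set σ} {i : σ} (hi : i ∉ T) :
    Ideal.Quotient.mk (Ideal.span (MvPolynomial.X '' T)) (MvPolynomial.X i : MvPolynomial σ R) ∈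
      nonZeroDivisors _ := by
  rw [mk_mem_nonZeroDivisors_iff]
  intro a ha
  rw [MvPolynomial.mem_ideal_span_X_image] at ha ⊢
  intro m hm
  have hmi : m + Finsupp.single i 1 ∈ (MvPolynomial.X i * a).support := by
    rwa [MvPolynomial.mem_support_iff, mul_comm, MvPolynomial.coeff_mul_X,
      ← MvPolynomial.mem_support_iff]
  obtain ⟨j, hj, hmj⟩ := ha _ hmi
  have hij : i ≠ j := fun h => hi (h ▸ hj)
  exact ⟨j, hj, by simpa [hij] using hmj⟩

theorem vanishes_quotient_span_X [LinearOrder σ] [Fintype σ] {q : ℕ} {T : Finset σ}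
    (hT : q + T.card < Fintype.card σ) :
    Vanishes (fun i => Ideal.Quotient.mk (Ideal.span (MvPolynomial.X '' (T : Set σ)))
      (MvPolynomial.X i : MvPolynomial σ R)) q := by
  obtain ⟨i, hi⟩ : ∃ i, i ∉ T := by
    by_contra! h
    rw [Finset.eq_univ_iff_forall.2 h, Finset.card_univ] at hT
    omega
  refine IsHypersurfaceQuotient.vanishes_of_vanishes (i := i)
    (.factor (mk_X_mem_nonZeroDivisors (Finset.mem_coe.not.2 hi)))
    (fun _ => Ideal.Quotient.factor_mk _ _) ?_
  rintro r rfl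
  have hcard : r + (insert i T).card < Fintype.card σ := by
    rw [Finset.card_insert_of_notMem hi]
    omega
  have hspan : Ideal.span (MvPolynomial.X '' (T : Set σ)) ⊔ Ideal.span {MvPolynomial.X i} =
      Ideal.span (MvPolynomial.X '' (insert i T : Finset σ) : Set (MvPolynomial σ R)) := by
    rw [Finset.coe_insert, Set.image_insert_eq, Ideal.span_insert, sup_comm]
  rw [hspan]
  exact vanishes_quotient_span_X hcard
termination_by q

end Cech

namespace CI

open Cech

variable {k : Type*} [Field k] {n : ℕ}

local notation "S" => MvPolynomial (Fin (n + 1)) k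

attribute [local instance] MvPolynomial.weightedGradedAlgebra

/-! ### Gradings -/

/-- The forms of degree `t ∈ ℤ`; for `t < 0` only `0` is one. -/
abbrev IsForm (a : S) (t : ℤ) : Prop := a.IsWeightedHomogeneous (fun _ => (1 : ℤ)) t

/-- Ideals generated by forms. -/
abbrev IsHomogeneousIdeal (J : Ideal S) : Prop :=
  J.IsHomogeneous (MvPolynomial.weightedHomogeneousSubmodule k fun _ => (1 : ℤ))

theorem weight_one_int (m : Fin (n + 1) →₀ ℕ) :
    Finsupp.weight (fun _ => (1 : ℤ)) m = (m.degree : ℤ) := by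
  simp [Finsupp.weight_apply, Finsupp.sum, Finsupp.degree_apply]

theorem isForm_of_isHomogeneous {a : S} {e : ℕ} (h : a.IsHomogeneous e) : IsForm a e :=
  fun m hm => by rw [weight_one_int, ← h hm, Finsupp.degree_eq_weight_one, Pi.one_def]

theorem IsForm.eq_zero_of_neg {a : S} {t : ℤ} (h : IsForm a t) (ht : t < 0) : a = 0 := by
  ext m
  by_contra hm
  have := h hm
  rw [weight_one_int] at this
  omega

theorem isForm_prod_X_pow (T : Finset (Fin (n + 1))) (N : ℕ) :
    IsForm ((∏ i ∈ T, MvPolynomial.X i : S) ^ N) (N * T.card) := by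
  have hT := MvPolynomial.IsWeightedHomogeneous.prod T (MvPolynomial.X (R := k))
    (fun _ => (1 : ℤ)) fun i _ => MvPolynomial.isWeightedHomogeneous_X k _ i
  simpa using hT.pow N

theorem mk_prod_X_pow (J : Ideal S) (T : Finset (Fin (n + 1))) (N : ℕ) :
    Ideal.Quotient.mk J ((∏ i ∈ T, MvPolynomial.X i) ^ N) = (∏ i ∈ T, vars J i) ^ N := by
  rw [map_pow, map_prod]
  rfl

theorem mem_of_sum_mem {J : Ideal S} (hJ : IsHomogeneousIdeal J) {s : Finset ℤ} {a : ℤ → S}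
    {e : ℤ} (ha : ∀ t ∈ s, IsForm (a t) (t + e)) (h : ∑ t ∈ s, a t ∈ J) {t : ℤ} (ht : t ∈ s) :
    a t ∈ J := by
  have hcomp := MvPolynomial.weightedHomogeneousComponent_mem_of_mem k _ hJ h (t + e)
  rwa [map_sum, Finset.sum_eq_single_of_mem t ht fun u hu hut =>
    (ha u hu).weightedHomogeneousComponent_ne _ fun h => hut (add_right_cancel h).symm,
    (ha t ht).weightedHomogeneousComponent_same] at hcomp

section Loc

variable {J : Ideal (MvPolynomial (Fin (n + 1)) k)} {T U : Finset (Fin (n + 1))} {t : ℤ}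

theorem mem_iSup_locDeg (z : Loc (vars J) T) : z ∈ iSup (locDeg J T) := by
  obtain ⟨N, a, ha⟩ := exists_mul_prod_pow_eq_algebraMap (vars J) T z
  obtain ⟨a, rfl⟩ := Ideal.Quotient.mk_surjective a
  induction a using DirectSum.Decomposition.inductionOn
    (MvPolynomial.weightedHomogeneousSubmodule k fun _ => (1 : ℤ)) generalizing z with
  | zero =>
    rw [map_zero, map_zero, (isUnit_algebraMap_prod_pow _ T N).mul_left_eq_zero] at ha
    exact ha ▸ zero_mem _
  | @homogeneous i a =>
    refine AddSubgroup.mem_iSup_of_mem (i - N * T.card) ⟨N, a, ?_, ha⟩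
    rw [sub_add_cancel]
    exact a.2
  | add a b iha ihb =>
    obtain ⟨z₁, h₁⟩ := exists_mul_prod_pow_eq (vars J) T N (Ideal.Quotient.mk J a)
    obtain ⟨z₂, h₂⟩ := exists_mul_prod_pow_eq (vars J) T N (Ideal.Quotient.mk J b)
    obtain rfl : z = z₁ + z₂ := (isUnit_algebraMap_prod_pow _ T N).mul_right_cancel <| by
      rw [ha, add_mul, h₁, h₂, map_add, map_add]
    exact add_mem (iha z₁ h₁) (ihb z₂ h₂)

theorem exists_forall_ge_of_mem_locDeg {z : Loc (vars J) T} (hz : z ∈ locDeg J T t) :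
    ∃ N₀ : ℕ, ∀ N ≥ N₀, ∃ a : S, IsForm a (t + N * T.card) ∧
      z * algebraMap _ (Loc (vars J) T) (∏ i ∈ T, vars J i) ^ N =
        algebraMap _ _ (Ideal.Quotient.mk J a) := by
  obtain ⟨N₀, a, ha, haz⟩ := hz
  refine ⟨N₀, fun N hN => ⟨a * (∏ i ∈ T, MvPolynomial.X i) ^ (N - N₀), ?_, ?_⟩⟩
  · convert! ha.mul (isForm_prod_X_pow (k := k) T (N - N₀)) using 1
    rw [Nat.cast_sub hN]
    ring
  · rw [map_mul, map_mul, mk_prod_X_pow, ← haz, map_pow, mul_assoc, ← pow_add,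
      Nat.add_sub_cancel' hN]

theorem eq_zero_of_sum_locDeg_eq_zero (hJ : IsHomogeneousIdeal J) {s : Finset ℤ}
    {w : ℤ → Loc (vars J) T} (hw : ∀ t, w t ∈ locDeg J T t) (h : ∑ t ∈ s, w t = 0) (ht : t ∈ s) :
    w t = 0 := by
  choose N₀ hN₀ using fun t => exists_forall_ge_of_mem_locDeg (hw t)
  let N := s.sup N₀
  choose! a ha haw using fun t (ht : t ∈ s) => hN₀ t N (Finset.le_sup ht)
  have hsum : algebraMap _ (Loc (vars J) T) (Ideal.Quotient.mk J (∑ t ∈ s, a t)) = 0 := by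
    rw [map_sum, map_sum, ← Finset.sum_congr rfl haw, ← Finset.sum_mul, h, zero_mul]
  obtain ⟨M, hM⟩ := (algebraMap_loc_eq_zero_iff _ T _).1 hsum
  rw [← mk_prod_X_pow, ← map_mul, Ideal.Quotient.eq_zero_iff_mem, Finset.mul_sum] at hM
  have hmem := mem_of_sum_mem hJ (e := N * T.card + M * T.card) (fun u hu => ?_) hM ht
  · rw [← Ideal.Quotient.eq_zero_iff_mem, map_mul, mk_prod_X_pow] at hmem
    rw [← (isUnit_algebraMap_prod_pow _ T N).mul_left_eq_zero, haw t ht]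
    exact (algebraMap_loc_eq_zero_iff _ T _).2 ⟨M, hmem⟩
  · convert! (isForm_prod_X_pow (k := k) T M).mul (ha u hu) using 1
    ring

theorem smul_mem_locDeg {h : S} {e : ℤ} (hh : IsForm h e) {z : Loc (vars J) T}
    (hz : z ∈ locDeg J T t) : Ideal.Quotient.mk J h • z ∈ locDeg J T (t + e) := by
  obtain ⟨N, a, ha, haz⟩ := hz
  refine ⟨N, h * a, ?_, ?_⟩
  · convert! hh.mul ha using 1
    ring
  · rw [map_mul]
    exact smul_mul_eq_algebraMap haz

theorem res_mem_locDeg (hTU : T ⊆ U) {z : Loc (vars J) T} (hz : z ∈ locDeg J T t) :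
    res (vars J) hTU z ∈ locDeg J U t := by
  obtain ⟨N, a, ha, haz⟩ := hz
  refine ⟨N, a * (∏ i ∈ U \ T, MvPolynomial.X i) ^ N, ?_, ?_⟩
  · convert! ha.mul (isForm_prod_X_pow (k := k) (U \ T) N) using 1
    rw [← Finset.card_sdiff_add_card_eq_card hTU]
    push_cast
    ring
  · rw [map_mul, mk_prod_X_pow]
    exact res_mul_prod_pow_eq hTU haz

theorem pow_mem_locDeg {z : Loc (vars J) T} (hz : z ∈ locDeg J T t) (p : ℕ) :
    z ^ p ∈ locDeg J T (p * t) := by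
  obtain ⟨N, a, ha, haz⟩ := hz
  refine ⟨N * p, a ^ p, ?_, ?_⟩
  · convert! ha.pow p using 1
    rw [nsmul_eq_mul]
    push_cast
    ring
  · rw [map_pow, map_pow, ← haz, mul_pow, pow_mul]

end Loc

theorem mem_iSup_pi {τ κ : Type*} [Finite κ] {M : κ → Type*} [∀ i, AddCommGroup (M i)]
    {𝒜 : ∀ i, τ → AddSubgroup (M i)} {z : ∀ i, M i} (hz : ∀ i, z i ∈ iSup (𝒜 i)) :
    z ∈ ⨆ t, AddSubgroup.pi Set.univ fun i => 𝒜 i t := by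
  classical
  cases nonempty_fintype κ
  rw [← Finset.univ_sum_single z]
  refine sum_mem fun i _ => ?_
  have hi := AddSubgroup.mem_map_of_mem (AddMonoidHom.single M i) (hz i)
  rw [AddSubgroup.map_iSup] at hi
  refine iSup_mono (fun t => AddSubgroup.map_le_iff_le_comap.2 fun v hv j _ => ?_) hi
  obtain rfl | hji := eq_or_ne j i
  · simpa using hv
  · simp [hji]

theorem exists_finsupp_sum_eq {M : Type*} [AddCommGroup M] {𝒜 : ℤ → AddSubgroup M} {z : M}
    (hz : z ∈ iSup 𝒜) : ∃ w : ℤ →₀ M, (∀ t, w t ∈ 𝒜 t) ∧ (w.sum fun _ v => v) = z := by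
  induction hz using AddSubgroup.iSup_induction' with
  | hp t z hz =>
    refine ⟨Finsupp.single t z, fun u => ?_, Finsupp.sum_single_index rfl⟩
    obtain rfl | hut := eq_or_ne t u
    · simpa using hz
    · simp [hut]
  | h1 => exact ⟨0, fun t => zero_mem _, Finsupp.sum_zero_index⟩
  | hadd z z' _ _ ih ih' =>
    obtain ⟨w, hw, rfl⟩ := ih
    obtain ⟨w', hw', rfl⟩ := ih'
    exact ⟨w + w', fun t => add_mem (hw t) (hw' t),
      Finsupp.sum_add_index' (fun _ => rfl) fun _ _ _ => rfl⟩

section Cochain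

variable {J : Ideal (MvPolynomial (Fin (n + 1)) k)} {q : ℕ} {t : ℤ}

theorem mem_cochainDeg {ω : Cochain (vars J) q} :
    ω ∈ cochainDeg J q t ↔ ∀ T, ω T ∈ locDeg J T.1 t := by
  simp only [cochainDeg, AddSubgroup.mem_pi, Set.mem_univ, forall_const]

theorem mem_iSup_cochainDeg (ω : Cochain (vars J) q) : ω ∈ iSup (cochainDeg J q) :=
  mem_iSup_pi fun T => mem_iSup_locDeg (ω T)

theorem eq_of_sum_eq_sum (hJ : IsHomogeneousIdeal J) {w w' : ℤ →₀ Cochain (vars J) q}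
    (hw : ∀ t, w t ∈ cochainDeg J q t) (hw' : ∀ t, w' t ∈ cochainDeg J q t)
    (h : (w.sum fun _ v => v) = w'.sum fun _ v => v) : w = w' := by
  rw [← sub_eq_zero, ← Finsupp.sum_sub_index fun _ _ _ => rfl] at h
  refine sub_eq_zero.1 <| Finsupp.ext fun t => funext fun T => ?_
  by_cases ht : t ∈ (w - w').support
  · refine eq_zero_of_sum_locDeg_eq_zero hJ (w := fun u => (w - w') u T)
      (fun u => sub_mem (mem_cochainDeg.1 (hw u) T) (mem_cochainDeg.1 (hw' u) T)) ?_ ht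
    simpa only [Finsupp.sum, Finset.sum_apply, Pi.zero_apply] using congrFun h T
  · rw [Finsupp.notMem_support_iff.1 ht]
    rfl

theorem smul_mem_cochainDeg {h : S} {e : ℤ} (hh : IsForm h e) {ω : Cochain (vars J) q}
    (hω : ω ∈ cochainDeg J q t) : Ideal.Quotient.mk J h • ω ∈ cochainDeg J q (t + e) :=
  mem_cochainDeg.2 fun T => smul_mem_locDeg hh (mem_cochainDeg.1 hω T)

theorem d_mem_cochainDeg {ω : Cochain (vars J) q} (hω : ω ∈ cochainDeg J q t) :
    d (vars J) q ω ∈ cochainDeg J (q + 1) t :=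
  mem_cochainDeg.2 fun T => d_apply_mem fun i =>
    res_mem_locDeg (face_subset T i) (mem_cochainDeg.1 hω (face T i))

theorem frobCochain_mem_cochainDeg {p : ℕ} [Fact p.Prime] [CharP k p] {ω : Cochain (vars J) q}
    (hω : ω ∈ cochainDeg J q t) :
    frobCochain (vars J) p (natCast_quot J p) q ω ∈ cochainDeg J q (p * t) :=
  mem_cochainDeg.2 fun T => pow_mem_locDeg (mem_cochainDeg.1 hω T) p

theorem exists_d_eq_of_sum_mem (hJ : IsHomogeneousIdeal J) {w : ℤ →₀ Cochain (vars J) (q + 1)}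
    (hw : ∀ t, w t ∈ cochainDeg J (q + 1) t)
    (h : (w.sum fun _ v => v) ∈ coboundaries (vars J) (q + 1)) (t : ℤ) :
    ∃ η ∈ cochainDeg J q t, d (vars J) q η = w t := by
  obtain ⟨η, hη⟩ := h
  obtain ⟨v, hv, rfl⟩ := exists_finsupp_sum_eq (mem_iSup_cochainDeg η)
  rw [eq_of_sum_eq_sum hJ hw (w' := v.mapRange (d (vars J) q) (map_zero _))
    (fun t => d_mem_cochainDeg (hv t))
    (by rw [← hη, map_finsuppSum, Finsupp.sum_mapRange_index fun _ => rfl])]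
  exact ⟨v t, hv t, rfl⟩

theorem mem_coboundaries_of_sum_mem (hJ : IsHomogeneousIdeal J) {w : ℤ →₀ Cochain (vars J) q}
    (hw : ∀ t, w t ∈ cochainDeg J q t) (h : (w.sum fun _ v => v) ∈ coboundaries (vars J) q)
    (t : ℤ) : w t ∈ coboundaries (vars J) q := by
  cases q with
  | zero =>
    rw [eq_of_sum_eq_sum hJ (w' := 0) hw (fun _ => zero_mem _) ((Submodule.mem_bot _).1 h)]
    exact zero_mem _
  | succ q =>
    obtain ⟨η, -, hη⟩ := exists_d_eq_of_sum_mem hJ hw h t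
    exact ⟨η, hη⟩

theorem single_mem_cochainDeg {ω : Cochain (vars J) q} (hω : ω ∈ cochainDeg J q t) (u : ℤ) :
    Finsupp.single t ω u ∈ cochainDeg J q u := by
  obtain rfl | hu := eq_or_ne t u
  · rwa [Finsupp.single_eq_same]
  · rw [Finsupp.single_eq_of_ne hu.symm]
    exact zero_mem _

theorem exists_mem_cochainDeg_d_eq (hJ : IsHomogeneousIdeal J) {ω : Cochain (vars J) (q + 1)}
    (hω : ω ∈ cochainDeg J (q + 1) t) (h : ω ∈ coboundaries (vars J) (q + 1)) :
    ∃ η ∈ cochainDeg J q t, d (vars J) q η = ω := by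
  simpa only [Finsupp.single_eq_same] using exists_d_eq_of_sum_mem hJ
    (single_mem_cochainDeg hω) (by rwa [Finsupp.sum_single_index rfl]) t

theorem mem_cochainDeg_of_smul_mem (hJ : IsHomogeneousIdeal J) {h : S} {e : ℤ} (hh : IsForm h e)
    (hreg : Ideal.Quotient.mk J h ∈ nonZeroDivisors (S ⧸ J)) {η : Cochain (vars J) q}
    (hη : Ideal.Quotient.mk J h • η ∈ cochainDeg J q (t + e)) : η ∈ cochainDeg J q t := by
  obtain ⟨v, hv, rfl⟩ := exists_finsupp_sum_eq (mem_iSup_cochainDeg η)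
  let φ := DistribSMul.toAddMonoidHom (Cochain (vars J) q) (Ideal.Quotient.mk J h)
  have hφv : (v.mapRange φ (map_zero φ)).mapDomain (· + e) =
      Finsupp.single (t + e) (φ (v.sum fun _ v => v)) := by
    refine eq_of_sum_eq_sum hJ (fun u => ?_) (single_mem_cochainDeg hη) ?_
    · obtain ⟨u, rfl⟩ : ∃ s, s + e = u := ⟨u - e, sub_add_cancel u e⟩
      rw [Finsupp.mapDomain_apply (add_left_injective e)]
      exact smul_mem_cochainDeg hh (hv u)
    · rw [Finsupp.sum_mapDomain_index (fun _ => rfl) fun _ _ _ => rfl,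
        Finsupp.sum_mapRange_index fun _ => rfl, Finsupp.sum_single_index rfl, map_finsuppSum]
  have hv0 (s : ℤ) (hst : s ≠ t) : v s = 0 := by
    have hs := DFunLike.congr_fun hφv (s + e)
    rw [Finsupp.mapDomain_apply (add_left_injective e), Finsupp.single_eq_of_ne (by simpa)] at hs
    exact smul_cochain_injective hreg q (hs.trans (smul_zero _).symm)
  rw [Finsupp.sum_eq_single t (fun s _ => hv0 s) fun _ => rfl]
  exact hv t

end Cochain

section Quotient

variable {J J' : Ideal (MvPolynomial (Fin (n + 1)) k)} {T : Finset (Fin (n + 1))} {q : ℕ} {t : ℤ}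

theorem factor_vars (hle : J ≤ J') (i : Fin (n + 1)) :
    Ideal.Quotient.factor hle (vars J i) = vars J' i :=
  rfl

/-- The map from the Čech complex of `S ⧸ J` to that of `S ⧸ J'`. -/
abbrev factorCochain (hle : J ≤ J') (q : ℕ) : Cochain (vars J) q →+ Cochain (vars J') q :=
  cochainMap (factor_vars hle) q

theorem exists_mem_locDeg_locMap_eq (hle : J ≤ J') {z : Loc (vars J') T} (hz : z ∈ locDeg J' T t) :
    ∃ w ∈ locDeg J T t,
      locMap (factor_vars hle) T w = z := by
  obtain ⟨N, a, ha, haz⟩ := hz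
  obtain ⟨w, hw⟩ := exists_mul_prod_pow_eq (vars J) T N (Ideal.Quotient.mk J a)
  refine ⟨w, ⟨N, a, ha, hw⟩, (isUnit_algebraMap_prod_pow _ T N).mul_right_cancel ?_⟩
  rw [haz]
  exact locMap_mul_prod_pow_eq _ hw

theorem locMap_mem_locDeg (hle : J ≤ J') {z : Loc (vars J) T} (hz : z ∈ locDeg J T t) :
    locMap (factor_vars hle) T z ∈ locDeg J' T t := by
  obtain ⟨N, a, ha, haz⟩ := hz
  exact ⟨N, a, ha, locMap_mul_prod_pow_eq _ haz⟩

theorem exists_mem_cochainDeg_factorCochain_eq (hle : J ≤ J') {ω : Cochain (vars J') q}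
    (hω : ω ∈ cochainDeg J' q t) : ∃ μ ∈ cochainDeg J q t, factorCochain hle q μ = ω := by
  choose μ hμ hμω using fun T : {T : Finset (Fin (n + 1)) // T.card = q} =>
    exists_mem_locDeg_locMap_eq hle (mem_cochainDeg.1 hω T)
  exact ⟨μ, mem_cochainDeg.2 hμ, funext fun T => hμω T⟩

theorem factorCochain_mem_cochainDeg (hle : J ≤ J') {ω : Cochain (vars J) q}
    (hω : ω ∈ cochainDeg J q t) : factorCochain hle q ω ∈ cochainDeg J' q t :=
  mem_cochainDeg.2 fun T => locMap_mem_locDeg hle (mem_cochainDeg.1 hω T)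

/-- The ideal of all `s ∈ S` which annihilate the class of `ω` modulo coboundaries. -/
def classAnn (ω : Cochain (vars J) q) : Ideal S :=
  ((coboundaries (vars J) q).colon {ω}).comap (Ideal.Quotient.mk J)

theorem mem_classAnn {ω : Cochain (vars J) q} {s : S} :
    s ∈ classAnn ω ↔ Ideal.Quotient.mk J s • ω ∈ coboundaries (vars J) q := by
  rw [classAnn, Ideal.mem_comap, Submodule.mem_colon_singleton]

theorem one_mem_classAnn {ω : Cochain (vars J) q} :
    1 ∈ classAnn ω ↔ ω ∈ coboundaries (vars J) q := by
  rw [mem_classAnn, map_one, one_smul]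

theorem le_classAnn (ω : Cochain (vars J) q) : J ≤ classAnn ω :=
  (Ideal.mk_ker (I := J)).ge.trans (Ideal.comap_mono bot_le)

theorem mul_mem_classAnn {ω : Cochain (vars J) q} {s a : S} :
    s * a ∈ classAnn ω ↔ s ∈ classAnn (Ideal.Quotient.mk J a • ω) := by
  rw [mem_classAnn, mem_classAnn, map_mul]
  exact iff_of_eq (congrArg (· ∈ _) (mul_smul_cochain _ _ ω))

end Quotient

section Connecting

variable {J : Ideal (MvPolynomial (Fin (n + 1)) k)} {h : MvPolynomial (Fin (n + 1)) k} {e t : ℤ}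
  {q : ℕ}

theorem classAnn_factorCochain (hreg : Ideal.Quotient.mk J h ∈ nonZeroDivisors (S ⧸ J))
    (hv : Vanishes (vars J) q) {ω : Cochain (vars J) q} {η : Cochain (vars J) (q + 1)}
    (hη : d (vars J) q ω = Ideal.Quotient.mk J h • η) :
    classAnn (factorCochain (le_sup_left : J ≤ J ⊔ Ideal.span {h}) q ω) =
      classAnn η := by
  ext s
  rw [mem_classAnn, mem_classAnn,
    ← (IsHypersurfaceQuotient.factor hreg).cochainMap_mem_coboundaries_iff (factor_vars _) hv
      (ω := Ideal.Quotient.mk J s • ω) (by rw [map_smul, hη, smul_comm]), cochainMap_smul]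
  rfl

/-- The connecting homomorphism of `0 → R(-e) → R → R / h → 0` is injective, lowers degrees by `e`
and commutes with Frobenius up to the factor `h ^ (p - 1)`. -/
theorem exists_connecting (hJ : IsHomogeneousIdeal J) (hh : IsForm h e)
    (hreg : Ideal.Quotient.mk J h ∈ nonZeroDivisors (S ⧸ J)) (p : ℕ) [Fact p.Prime]
    [CharP k p] (hv : Vanishes (vars J) q) {ω : Cochain (vars (J ⊔ Ideal.span {h})) q}
    (hω : d (vars (J ⊔ Ideal.span {h})) q ω = 0)
    (ht : ω ∈ cochainDeg (J ⊔ Ideal.span {h}) q t) :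
    ∃ η ∈ cochainDeg J (q + 1) (t - e), d (vars J) (q + 1) η = 0 ∧ classAnn ω = classAnn η ∧
      ∀ s, s ∈ classAnn (frobCochain (vars (J ⊔ Ideal.span {h})) p (natCast_quot _ p) q ω) ↔
        s * h ^ (p - 1) ∈ classAnn (frobCochain (vars J) p (natCast_quot J p) (q + 1) η) := by
  obtain ⟨ω, hωt, rfl⟩ := exists_mem_cochainDeg_factorCochain_eq le_sup_left ht
  obtain ⟨η, hη, hdη⟩ := (IsHypersurfaceQuotient.factor hreg).exists_d_eq_smul (factor_vars _) hω
  refine ⟨η, mem_cochainDeg_of_smul_mem hJ hh hreg ?_, hdη, classAnn_factorCochain hreg hv hη,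
    fun s => ?_⟩
  · rw [← hη, sub_add_cancel]
    exact d_mem_cochainDeg hωt
  · have hF : d (vars J) q (frobCochain (vars J) p (natCast_quot J p) q ω) =
        Ideal.Quotient.mk J h • Ideal.Quotient.mk J (h ^ (p - 1)) •
          frobCochain (vars J) p (natCast_quot J p) (q + 1) η := by
      rw [map_pow]
      exact d_frobCochain_of_d_eq_smul _ hη
    rw [factorCochain, ← cochainMap_frobCochain (factor_vars _) (natCast_quot J p), ← factorCochain,
      classAnn_factorCochain hreg hv hF, mul_mem_classAnn]

/-- The connecting homomorphism of `0 → R(-e) → R → R / h → 0` is surjective onto the classes which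
are annihilated by `h`. -/
theorem exists_connecting_lift (hJ : IsHomogeneousIdeal J) (hh : IsForm h e)
    (hreg : Ideal.Quotient.mk J h ∈ nonZeroDivisors (S ⧸ J)) (hv : Vanishes (vars J) q)
    {η : Cochain (vars J) (q + 1)} (ht : η ∈ cochainDeg J (q + 1) t) (hη : h ∈ classAnn η) :
    ∃ ω ∈ cochainDeg (J ⊔ Ideal.span {h}) q (t + e), classAnn ω = classAnn η := by
  obtain ⟨ω, hωt, hω⟩ :=
    exists_mem_cochainDeg_d_eq hJ (smul_mem_cochainDeg hh ht) (mem_classAnn.1 hη)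
  exact ⟨_, factorCochain_mem_cochainDeg le_sup_left hωt, classAnn_factorCochain hreg hv hω⟩

end Connecting

/-! ### Top cohomology of the polynomial ring -/

section PowIdeal

variable {R σ : Type*} [CommRing R] {m M : ℕ} {a : MvPolynomial σ R}

variable (R σ) in
/-- The ideal generated by the `m`-th powers of the variables. -/
def powIdeal (m : ℕ) : Ideal (MvPolynomial σ R) :=
  Ideal.span (Set.range fun i => MvPolynomial.X i ^ m)

theorem mem_powIdeal : a ∈ powIdeal R σ m ↔ ∀ μ ∈ a.support, ∃ i, m ≤ μ i := by
  have hspan : powIdeal R σ m = Ideal.span ((fun s => MvPolynomial.monomial s (1 : R)) ''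
      Set.range fun i => Finsupp.single i m) := by
    simp only [powIdeal, ← Set.range_comp, MvPolynomial.X_pow_eq_monomial, Function.comp_def]
  simp [hspan, MvPolynomial.mem_ideal_span_monomial_image]

theorem mem_powIdeal_of_prod_X_pow_mul_mem [Fintype σ]
    (ha : (∏ i, MvPolynomial.X i) ^ M * a ∈ powIdeal R σ (m + M)) : a ∈ powIdeal R σ m := by
  have hX : (∏ i, MvPolynomial.X i : MvPolynomial σ R) ^ M =
      MvPolynomial.monomial (Finsupp.equivFunOnFinite.symm fun _ => M) 1 := by
    rw [MvPolynomial.monomial_eq, map_one, one_mul, ← Finset.prod_pow,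
      Finsupp.prod_fintype _ _ fun i => pow_zero _]
    rfl
  rw [mem_powIdeal, hX] at ha
  refine mem_powIdeal.2 fun μ hμ => ?_
  obtain ⟨i, hi⟩ := ha (Finsupp.equivFunOnFinite.symm (fun _ => M) + μ) <| by
    rwa [MvPolynomial.mem_support_iff, MvPolynomial.coeff_monomial_mul, one_mul,
      ← MvPolynomial.mem_support_iff]
  rw [Finsupp.add_apply, Finsupp.equivFunOnFinite_symm_apply_apply, add_comm m] at hi
  exact ⟨i, Nat.le_of_add_le_add_left hi⟩

end PowIdeal

/-- The index of the only component of a Čech cochain of degree `n + 1`. -/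
def topIndex (n : ℕ) : {T : Finset (Fin (n + 1)) // T.card = n + 1} :=
  ⟨Finset.univ, by simp⟩

/-- The cochain `η` on the polynomial ring is the fraction `g / (x_0 ⋯ x_n) ^ m`. -/
def IsFraction (η : Cochain (vars (⊥ : Ideal S)) (n + 1)) (g : S) (m : ℕ) : Prop :=
  η (topIndex n) * algebraMap _ _ (∏ i ∈ (topIndex n).1, vars (⊥ : Ideal S) i) ^ m =
    algebraMap _ _ (Ideal.Quotient.mk ⊥ g)

section IsFraction

variable {η : Cochain (vars (⊥ : Ideal (MvPolynomial (Fin (n + 1)) k))) (n + 1)}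
  {g : MvPolynomial (Fin (n + 1)) k} {m : ℕ} {t : ℤ}

theorem exists_isFraction (hη : η ∈ cochainDeg ⊥ (n + 1) t) :
    ∃ (g : S) (m : ℕ), IsForm g (t + m * (n + 1)) ∧ IsFraction η g m := by
  obtain ⟨m, g, hg, hgη⟩ := mem_cochainDeg.1 hη (topIndex n)
  rw [(topIndex n).2] at hg
  exact ⟨g, m, mod_cast hg, hgη⟩

theorem IsForm.exists_isFraction (hg : IsForm g (t + m * (n + 1))) :
    ∃ η ∈ cochainDeg (⊥ : Ideal S) (n + 1) t, IsFraction η g m := by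
  choose η hη using fun T : {T : Finset (Fin (n + 1)) // T.card = n + 1} =>
    exists_mul_prod_pow_eq (vars ⊥) T.1 m (Ideal.Quotient.mk ⊥ g)
  refine ⟨η, mem_cochainDeg.2 fun T => ⟨m, g, ?_, hη T⟩, hη _⟩
  rw [T.2]
  exact mod_cast hg

theorem IsFraction.frobCochain (hη : IsFraction η g m) (p : ℕ) [Fact p.Prime] [CharP k p] :
    IsFraction (frobCochain (vars ⊥) p (natCast_quot ⊥ p) (n + 1) η) (g ^ p) (m * p) := by
  rw [IsFraction, pow_mul, map_pow, map_pow, ← hη, mul_pow]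
  rfl

theorem IsFraction.mem_classAnn_iff (hη : IsFraction η g m) (s : S) :
    s ∈ classAnn η ↔ s * g ∈ powIdeal k (Fin (n + 1)) m := by
  have hspan (M : ℕ) : Ideal.span (Set.range fun i => vars (⊥ : Ideal S) i ^ (m + M)) =
      (powIdeal k (Fin (n + 1)) (m + M)).map (Ideal.Quotient.mk ⊥) := by
    rw [powIdeal, Ideal.map_span, ← Set.range_comp]
    rfl
  have hmk (M : ℕ) : (∏ i, vars ⊥ i) ^ M * (Ideal.Quotient.mk ⊥ s * Ideal.Quotient.mk ⊥ g) =
      Ideal.Quotient.mk ⊥ ((∏ i, MvPolynomial.X i) ^ M * (s * g)) := by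
    rw [map_mul, mk_prod_X_pow, map_mul]
  rw [mem_classAnn, mem_coboundaries_top_iff (T := topIndex n) rfl (smul_mul_eq_algebraMap hη)]
  simp only [hspan, hmk, Ideal.mem_quotient_iff_mem_sup, sup_bot_eq]
  refine ⟨fun ⟨M, hM⟩ => mem_powIdeal_of_prod_X_pow_mul_mem hM, fun h => ⟨0, ?_⟩⟩
  rwa [pow_zero, one_mul, add_zero]

end IsFraction

theorem eq_zero_of_mem_cochainDeg_zero {J : Ideal (MvPolynomial (Fin (n + 1)) k)} {t : ℤ}
    (ht : t < 0) {ω : Cochain (vars J) 0} (hω : ω ∈ cochainDeg J 0 t) : ω = 0 := by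
  funext T
  obtain ⟨N, a, ha, haz⟩ := mem_cochainDeg.1 hω T
  rw [T.2, Nat.cast_zero, mul_zero, add_zero] at ha
  rw [IsForm.eq_zero_of_neg ha ht, map_zero, map_zero] at haz
  exact (isUnit_algebraMap_prod_pow _ _ N).mul_left_eq_zero.1 haz

/-! ### Complete intersections -/

/-- `IsCompleteIntersection J c d P` says that `J` is generated by a regular sequence of `c` forms
of total degree `d` and with product `P`. -/
inductive IsCompleteIntersection :
    Ideal (MvPolynomial (Fin (n + 1)) k) → ℕ → ℤ → MvPolynomial (Fin (n + 1)) k → Prop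
  | nil : IsCompleteIntersection ⊥ 0 0 1
  | cons {J : Ideal (MvPolynomial (Fin (n + 1)) k)} {c : ℕ} {d e : ℤ}
      {P h : MvPolynomial (Fin (n + 1)) k} : IsCompleteIntersection J c d P → IsForm h e →
      Ideal.Quotient.mk J h ∈ nonZeroDivisors (MvPolynomial (Fin (n + 1)) k ⧸ J) →
      IsCompleteIntersection (J ⊔ Ideal.span {h}) (c + 1) (d + e) (P * h)

namespace IsCompleteIntersection

variable {J : Ideal (MvPolynomial (Fin (n + 1)) k)} {P : MvPolynomial (Fin (n + 1)) k}
  {c q : ℕ} {δ t : ℤ}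

theorem isHomogeneousIdeal (H : IsCompleteIntersection J c δ P) : IsHomogeneousIdeal J := by
  induction H with
  | nil => exact .bot _
  | cons _ hh _ ih =>
    exact ih.sup (Ideal.homogeneous_span _ _ fun _ hx => ⟨_, Set.mem_singleton_iff.1 hx ▸ hh⟩)

theorem vanishes (H : IsCompleteIntersection J c δ P) (hq : q + c < n + 1) :
    Vanishes (vars J) q := by
  induction H generalizing q with
  | nil =>
    have hv := vanishes_quotient_span_X (R := k) (T := (∅ : Finset (Fin (n + 1)))) (q := q)
      (by simpa using hq)
    rwa [Finset.coe_empty, Set.image_empty, Ideal.span_empty] at hv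
  | cons _ _ hreg ih =>
    exact (IsHypersurfaceQuotient.factor hreg).vanishes (factor_vars _) (ih (by omega))
      (ih (by omega))

/-- The iterated connecting homomorphism embeds `H^{n + 1 - c}` of the complete intersection into
the top cohomology of the polynomial ring. -/
theorem exists_top (H : IsCompleteIntersection J c δ P) (p : ℕ) [Fact p.Prime] [CharP k p]
    (hq : q + c = n + 1) {ω : Cochain (vars J) q} (hω : d (vars J) q ω = 0)
    (ht : ω ∈ cochainDeg J q t) :
    ∃ η ∈ cochainDeg ⊥ (n + 1) (t - δ), classAnn ω = classAnn η ∧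
      ∀ s, s ∈ classAnn (frobCochain (vars J) p (natCast_quot J p) q ω) ↔
        s * P ^ (p - 1) ∈ classAnn (frobCochain (vars ⊥) p (natCast_quot ⊥ p) (n + 1) η) := by
  induction H generalizing q t with
  | nil =>
    obtain rfl : q = n + 1 := hq
    exact ⟨ω, by rwa [sub_zero], rfl, fun s => by rw [one_pow, mul_one]⟩
  | @cons J c d e P h H hh hreg ih =>
    obtain ⟨η', hη't, hdη', hη', hFη'⟩ := exists_connecting H.isHomogeneousIdeal hh hreg p
      (H.vanishes (by omega)) hω ht
    obtain ⟨η, hηt, hη, hFη⟩ := ih (by omega) hdη' hη't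
    refine ⟨η, ?_, hη'.trans hη, fun s => ?_⟩
    · rwa [add_comm d, ← sub_sub]
    · rw [hFη', hFη, mul_assoc, ← mul_pow, mul_comm h]

/-- The image of the embedding `exists_top` contains every class annihilated by `J`. -/
theorem exists_of_top (H : IsCompleteIntersection J c δ P) (hq : q + c = n + 1)
    {η : Cochain (vars (⊥ : Ideal S)) (n + 1)} (ht : η ∈ cochainDeg ⊥ (n + 1) t)
    (hη : J ≤ classAnn η) : ∃ ω ∈ cochainDeg J q (t + δ), classAnn ω = classAnn η := by
  induction H generalizing q with
  | nil =>
    obtain rfl : q = n + 1 := hq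
    exact ⟨η, by rwa [add_zero], rfl⟩
  | @cons J c d e P h H hh hreg ih =>
    obtain ⟨η', hη't, hη'⟩ := ih (q := q + 1) (by omega) (le_sup_left.trans hη)
    obtain ⟨ω, hωt, hω⟩ := exists_connecting_lift H.isHomogeneousIdeal hh hreg
      (H.vanishes (by omega)) hη't <| by
        rw [hη']
        exact hη (Ideal.mem_sup_right (Ideal.mem_span_singleton_self h))
    refine ⟨ω, ?_, hω.trans hη'⟩
    rwa [← add_assoc]

theorem of_isWeaklyRegular {c : ℕ} {f : Fin c → MvPolynomial (Fin (n + 1)) k} {deg : Fin c → ℤ}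
    (hf : ∀ j, IsForm (f j) (deg j))
    (hreg : RingTheory.Sequence.IsWeaklyRegular S (List.ofFn f)) :
    IsCompleteIntersection (Ideal.span (Set.range f)) c (∑ j, deg j) (∏ j, f j) := by
  induction c with
  | zero => simpa using IsCompleteIntersection.nil (k := k) (n := n)
  | succ c ih =>
    rw [List.ofFn_succ', List.concat_eq_append,
      RingTheory.Sequence.isWeaklyRegular_append_iff,
      RingTheory.Sequence.isWeaklyRegular_singleton_iff] at hreg
    have hspan : Ideal.ofList (List.ofFn fun j : Fin c => f j.castSucc) =
        Ideal.span (Set.range fun j : Fin c => f j.castSucc) := by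
      rw [Ideal.ofList]
      congr 1
      ext
      simp
    have hrange : Ideal.span (Set.range f) =
        Ideal.span (Set.range fun j : Fin c => f j.castSucc) ⊔ Ideal.span {f (Fin.last c)} := by
      rw [← Ideal.span_union, Set.union_comm, ← Set.insert_eq, ← Fin.range_snoc]
      congr 2
      exact (Fin.snoc_init_self f).symm
    rw [hrange, Fin.sum_univ_castSucc, Fin.prod_univ_castSucc]
    refine (ih (fun j => hf j.castSucc) hreg.1).cons (hf _) (mk_mem_nonZeroDivisors_iff.2 ?_)
    have := (isSMulRegular_quotient_iff_mem_of_smul_mem _ _).1 hreg.2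
    simpa [hspan] using this

end IsCompleteIntersection

/-! ### Colon ideals of powers of the variables -/

theorem exists_mem_nonZeroDivisors {k A : Type*} [Field k] [Infinite k] [CommRing A]
    [IsNoetherianRing A] [Algebra k A] (V : Submodule k A)
    (hV : ∀ P ∈ associatedPrimes A A, ¬ (V : Set A) ⊆ P) : ∃ a ∈ V, a ∈ nonZeroDivisors A := by
  classical
  have hfin := associatedPrimes.finite A A
  let W (P : Ideal A) : Subspace k V := (P.restrictScalars k).comap V.subtype
  have hW : ⊤ ∉ hfin.toFinset.image W := by
    rw [Finset.mem_image]
    rintro ⟨P, hP, hPW⟩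
    exact hV P (hfin.mem_toFinset.1 hP) fun a ha =>
      show (⟨a, ha⟩ : V) ∈ W P from hPW ▸ Submodule.mem_top
  obtain ⟨a, ha⟩ := (Set.ne_univ_iff_exists_notMem _).1
    (Subspace.biUnion_ne_univ_of_top_notMem hW)
  refine ⟨a, a.2, not_not.1 fun h => ?_⟩
  have hmem : (a : A) ∈ ((nonZeroDivisors A : Set A)ᶜ) := h
  rw [← biUnion_associatedPrimes_eq_compl_nonZeroDivisors] at hmem
  obtain ⟨P, hP, haP⟩ := Set.mem_iUnion₂.1 hmem
  exact ha (Set.mem_iUnion₂.2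
    ⟨W P, Finset.mem_image_of_mem W (hfin.mem_toFinset.2 hP), haP⟩)

theorem exists_mem_nonZeroDivisors_mk [Infinite k] {J : Ideal (MvPolynomial (Fin (n + 1)) k)}
    (hv : Vanishes (vars J) 0) (V : Submodule k (MvPolynomial (Fin (n + 1)) k))
    (hV : Ideal.span (Set.range MvPolynomial.X) ≤
      (J ⊔ Ideal.span (V : Set (MvPolynomial (Fin (n + 1)) k))).radical) :
    ∃ ℓ ∈ V, Ideal.Quotient.mk J ℓ ∈ nonZeroDivisors (S ⧸ J) := by
  suffices h : ∀ P ∈ associatedPrimes (S ⧸ J) (S ⧸ J),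
      ¬ (V.map (Ideal.Quotient.mkₐ k J).toLinearMap : Set (S ⧸ J)) ⊆ P by
    obtain ⟨_, ⟨ℓ, hℓ, rfl⟩, hreg⟩ := exists_mem_nonZeroDivisors _ h
    exact ⟨ℓ, hℓ, hreg⟩
  intro P hP hVP
  obtain ⟨hprime, a, rfl⟩ := isAssociatedPrime_iff.1 hP
  have hle : J ⊔ Ideal.span (V : Set S) ≤ Ideal.comap (Ideal.Quotient.mk J) (.colon ⊥ {a}) :=
    sup_le (by rw [← Ideal.map_le_iff_le_comap, Ideal.map_quotient_self]; exact bot_le)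
      (Ideal.span_le.2 fun b hb => hVP ⟨b, hb, rfl⟩)
  have ha : a = 0 := hv.eq_zero_of_forall_mul_eq_zero fun i => by
    have hi := (hprime.comap (Ideal.Quotient.mk J)).radical_le_iff.2 hle
      (hV (Ideal.subset_span ⟨i, rfl⟩))
    rwa [Ideal.mem_comap, Submodule.mem_colon_singleton] at hi
  exact hprime.ne_top (by simp [ha])

/-- By prime avoidance the regular sequence can be continued inside `V`. -/
theorem IsCompleteIntersection.extend [Infinite k] {J : Ideal (MvPolynomial (Fin (n + 1)) k)}
    {c : ℕ} {d δ : ℤ} {P : MvPolynomial (Fin (n + 1)) k} (H : IsCompleteIntersection J c d P)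
    {V : Submodule k (MvPolynomial (Fin (n + 1)) k)} (hVδ : ∀ a ∈ V, IsForm a δ)
    (hV : Ideal.span (Set.range MvPolynomial.X) ≤
      (J ⊔ Ideal.span (V : Set (MvPolynomial (Fin (n + 1)) k))).radical)
    {r : ℕ} (hr : c + r ≤ n + 1) :
    ∃ J' P', J ≤ J' ∧ J' ≤ J ⊔ Ideal.span (V : Set (MvPolynomial (Fin (n + 1)) k)) ∧
      IsCompleteIntersection J' (c + r) (d + r * δ) P' := by
  induction r with
  | zero => exact ⟨J, P, le_rfl, le_sup_left, by simpa using H⟩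
  | succ r ih =>
    obtain ⟨J', P', hle, hge, H'⟩ := ih (by omega)
    obtain ⟨ℓ, hℓ, hreg⟩ := exists_mem_nonZeroDivisors_mk (H'.vanishes (by omega)) V
      (hV.trans (Ideal.radical_mono (sup_le_sup_right hle _)))
    refine ⟨J' ⊔ Ideal.span {ℓ}, P' * ℓ, hle.trans le_sup_left, sup_le hge ?_, ?_⟩
    · rw [Ideal.span_singleton_le_iff_mem]
      exact Ideal.mem_sup_right (Ideal.subset_span hℓ)
    · convert! H'.cons (hVδ ℓ hℓ) hreg using 1
      push_cast
      ring

/-- The fraction `g / (x_0 ⋯ x_n) ^ L` comes from a class in `H^0` of negative degree of a complete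
intersection of dimension zero. -/
theorem IsCompleteIntersection.mem_powIdeal_of_forall_mul_mem
    {J : Ideal (MvPolynomial (Fin (n + 1)) k)} {d u : ℤ} {P g : MvPolynomial (Fin (n + 1)) k}
    (H : IsCompleteIntersection J (n + 1) d P) {L : ℕ} (hg : IsForm g u)
    (hu : u + d < L * (n + 1)) (hgJ : ∀ a ∈ J, a * g ∈ powIdeal k (Fin (n + 1)) L) :
    g ∈ powIdeal k (Fin (n + 1)) L := by
  obtain ⟨η, hη, hηg⟩ := IsForm.exists_isFraction (t := u - L * (n + 1)) (m := L)
    (by rwa [sub_add_cancel])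
  obtain ⟨ω, hωt, hω⟩ := H.exists_of_top (zero_add _) hη fun a ha =>
    (hηg.mem_classAnn_iff a).2 (hgJ a ha)
  have hmem : 1 ∈ classAnn η := by
    rw [← hω, one_mem_classAnn, eq_zero_of_mem_cochainDeg_zero (by linarith) hωt]
    exact Submodule.zero_mem _
  rwa [hηg.mem_classAnn_iff, one_mul] at hmem

theorem IsCompleteIntersection.mem_powIdeal_of_infinite [Infinite k]
    {J : Ideal (MvPolynomial (Fin (n + 1)) k)} {c : ℕ} {d δ u : ℤ}
    {P g : MvPolynomial (Fin (n + 1)) k} (H : IsCompleteIntersection J c d P) (hc : c ≤ n + 1)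
    {M : Set (MvPolynomial (Fin (n + 1)) k)} (hM : ∀ a ∈ M, IsForm a δ)
    (hrad : Ideal.span (Set.range MvPolynomial.X) ≤ (J ⊔ Ideal.span M).radical) {L : ℕ}
    (hg : IsForm g u) (hu : u + d + (n + 1 - c) * δ < L * (n + 1))
    (hgM : ∀ a ∈ J ⊔ Ideal.span M, a * g ∈ powIdeal k (Fin (n + 1)) L) :
    g ∈ powIdeal k (Fin (n + 1)) L := by
  have hspan : Ideal.span (Submodule.span k M : Set S) = Ideal.span M :=
    Submodule.span_span_of_tower k S M
  have hV : ∀ a ∈ Submodule.span k M, IsForm a δ := Submodule.span_le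
    (p := MvPolynomial.weightedHomogeneousSubmodule k (fun _ => (1 : ℤ)) δ) |>.2 hM
  obtain ⟨J', P', -, hJ', H'⟩ := H.extend hV (by rwa [hspan]) (r := n + 1 - c)
    (by omega)
  rw [Nat.add_sub_cancel' hc] at H'
  refine H'.mem_powIdeal_of_forall_mul_mem hg ?_ fun a ha => hgM a ?_
  · push_cast [Nat.cast_sub hc]
    linarith
  · rw [← hspan]
    exact hJ' ha

section BaseChange

variable {σ R K : Type*} [CommRing R] [CommRing K] [Algebra R K]

theorem isWeaklyRegular_map [Module.Flat R K] {f : List (MvPolynomial σ R)}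
    (hf : RingTheory.Sequence.IsWeaklyRegular (MvPolynomial σ R) f) :
    RingTheory.Sequence.IsWeaklyRegular (MvPolynomial σ K)
      (f.map (MvPolynomial.map (algebraMap R K))) := by
  let : Algebra (MvPolynomial σ R) (MvPolynomial σ K) := MvPolynomial.algebraMvPolynomial
  have := Module.Flat.isBaseChange R (MvPolynomial σ R) K (MvPolynomial σ K)
    Algebra.IsPushout.out
  exact hf.of_flat

theorem map_mem_powIdeal_iff [FaithfulSMul R K] {a : MvPolynomial σ R} {m : ℕ} :
    MvPolynomial.map (algebraMap R K) a ∈ powIdeal K σ m ↔ a ∈ powIdeal R σ m := by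
  rw [mem_powIdeal, mem_powIdeal,
    MvPolynomial.support_map_of_injective a (FaithfulSMul.algebraMap_injective R K)]

end BaseChange

theorem IsForm.map {K : Type*} [Field K] (φ : k →+* K) {a : MvPolynomial (Fin (n + 1)) k} {t : ℤ}
    (ha : IsForm a t) : IsForm (MvPolynomial.map φ a) t := by
  intro m hm
  refine ha fun h => hm ?_
  rw [MvPolynomial.coeff_map, h, map_zero]

theorem mem_powIdeal_of_forall_mul_mem {c : ℕ} {f : Fin c → MvPolynomial (Fin (n + 1)) k}
    {deg : Fin c → ℤ} {g : MvPolynomial (Fin (n + 1)) k} {δ u : ℤ}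
    (hf : ∀ j, IsForm (f j) (deg j))
    (hreg : RingTheory.Sequence.IsWeaklyRegular S (List.ofFn f)) (hc : c ≤ n + 1)
    {M : Set (MvPolynomial (Fin (n + 1)) k)} (hM : ∀ a ∈ M, IsForm a δ)
    (hrad : Ideal.span (Set.range MvPolynomial.X) ≤
      (Ideal.span (Set.range f) ⊔ Ideal.span M).radical) {L : ℕ}
    (hg : IsForm g u) (hu : u + ∑ j, deg j + (n + 1 - c) * δ < L * (n + 1))
    (hgM : ∀ a ∈ Ideal.span (Set.range f) ⊔ Ideal.span M, a * g ∈ powIdeal k (Fin (n + 1)) L) :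
    g ∈ powIdeal k (Fin (n + 1)) L := by
  let φ := MvPolynomial.map (σ := Fin (n + 1)) (algebraMap k (AlgebraicClosure k))
  have hmap : (Ideal.span (Set.range f) ⊔ Ideal.span M).map φ =
      Ideal.span (Set.range fun j => φ (f j)) ⊔ Ideal.span (φ '' M) := by
    rw [Ideal.map_sup, Ideal.map_span, Ideal.map_span, ← Set.range_comp]
    rfl
  have hreg' := isWeaklyRegular_map (K := AlgebraicClosure k) hreg
  rw [List.map_ofFn] at hreg'
  rw [← map_mem_powIdeal_iff (K := AlgebraicClosure k)]
  refine (IsCompleteIntersection.of_isWeaklyRegular (fun j => (hf j).map _)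
    hreg').mem_powIdeal_of_infinite hc (M := φ '' M) (δ := δ) ?_ ?_ (hg.map _) hu ?_
  · rintro _ ⟨a, ha, rfl⟩
    exact (hM a ha).map _
  · rw [Ideal.span_le]
    rintro _ ⟨i, rfl⟩
    obtain ⟨r, hr⟩ := hrad (Ideal.subset_span ⟨i, rfl⟩)
    refine ⟨r, ?_⟩
    rw [← MvPolynomial.map_X (algebraMap k (AlgebraicClosure k)) i, ← map_pow]
    exact hmap ▸ Ideal.mem_map_of_mem φ hr
  · intro a ha
    have hle : (Ideal.span (Set.range f) ⊔ Ideal.span M).map φ ≤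
        (powIdeal (AlgebraicClosure k) (Fin (n + 1)) L).colon {φ g} :=
      Ideal.map_le_iff_le_comap.2 fun b hb => by
        rw [Ideal.mem_comap, Submodule.mem_colon_singleton, smul_eq_mul, ← map_mul]
        exact map_mem_powIdeal_iff.2 (hgM b hb)
    exact Submodule.mem_colon_singleton.1 (hle (hmap ▸ ha))

/-! ### Frobenius powers, derivations and Jacobian minors -/

theorem pow_mem_powIdeal_iff {R σ : Type*} [CommRing R] [IsReduced R] {p : ℕ} [Fact p.Prime]
    [CharP R p] {m : ℕ} {a : MvPolynomial σ R} :
    a ^ p ∈ powIdeal R σ (m * p) ↔ a ∈ powIdeal R σ m := by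
  have hp := Fact.out (p := p.Prime)
  refine ⟨fun h => mem_powIdeal.2 fun μ hμ => ?_, fun h => ?_⟩
  · obtain ⟨i, hi⟩ := mem_powIdeal.1 h (p • μ) <| by
      rw [MvPolynomial.mem_support_iff] at hμ ⊢
      rw [← MvPolynomial.map_frobenius_expand, MvPolynomial.coeff_map,
        MvPolynomial.coeff_expand_smul _ hp.ne_zero]
      exact pow_ne_zero p hμ
    rw [Finsupp.smul_apply, smul_eq_mul, mul_comm] at hi
    exact ⟨i, Nat.le_of_mul_le_mul_left hi hp.pos⟩
  · suffices hle : powIdeal R σ m ≤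
        (powIdeal R σ (m * p)).comap (frobenius (MvPolynomial σ R) p) from hle h
    rw [powIdeal, Ideal.span_le]
    rintro _ ⟨i, rfl⟩
    exact Ideal.subset_span ⟨i, pow_mul _ m p⟩

section Derivation

variable {R A : Type*} [CommRing R] [CommRing A] [Algebra R A] (D : Derivation R A A)

theorem derivation_mem_span {s : Set A} (hs : ∀ x ∈ s, D x = 0) {a : A} (ha : a ∈ Ideal.span s) :
    D a ∈ Ideal.span s := by
  induction ha using Submodule.span_induction with
  | mem x hx => exact hs x hx ▸ zero_mem _
  | zero => simp only [map_zero, zero_mem]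
  | add x y _ _ hx hy => exact D.map_add x y ▸ add_mem hx hy
  | smul b x hx ih =>
    rw [smul_eq_mul, D.leibniz]
    exact add_mem (Ideal.mul_mem_left _ _ ih) (Ideal.mul_mem_right _ _ hx)

theorem derivation_pow_char (p : ℕ) [CharP A p] (a : A) : D (a ^ p) = 0 := by
  rw [D.leibniz_pow, nsmul_eq_mul, CharP.cast_eq_zero, zero_mul]

theorem derivation_prod_eq_zero {ι : Type*} {s : Finset ι} {g : ι → A}
    (hg : ∀ i ∈ s, D (g i) = 0) : D (∏ i ∈ s, g i) = 0 :=
  Finset.prod_induction g (D · = 0)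
    (fun a b ha hb => by rw [D.leibniz, ha, hb, smul_zero, smul_zero, add_zero])
    D.map_one_eq_zero hg

theorem derivation_mul_pow_mul_mem {I : Ideal A} (hI : ∀ a ∈ I, D a ∈ I) {x u : A}
    (hu : D u = 0) {e : ℕ} (he : IsUnit ((e + 1 : ℕ) : A)) (h : x ^ (e + 1) * u ∈ I) :
    D x * (x ^ e * u) ∈ I := by
  rw [← Ideal.unit_mul_mem_iff_mem I he]
  convert! hI _ h using 1
  rw [D.leibniz, hu, D.leibniz_pow, Nat.add_sub_cancel, smul_zero, zero_add, nsmul_eq_mul,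
    smul_eq_mul, smul_eq_mul]
  ring

end Derivation

section Jacobian

variable {R σ ι : Type*} [CommRing R] [Fintype ι] [DecidableEq ι]

/-- The square submatrix of the Jacobian matrix of the polynomials `f j` formed by the partial
derivatives with respect to the variables `X (r a)`; rows are indexed by the variables. -/
def jacobianMatrix (f : ι → MvPolynomial σ R) (r : ι → σ) : Matrix ι ι (MvPolynomial σ R) :=
  Matrix.of fun a j => MvPolynomial.pderiv (r a) (f j)

theorem exists_derivation_eq_det (f : ι → MvPolynomial σ R) (r : ι → σ) (l : ι) :
    ∃ D : Derivation R (MvPolynomial σ R) (MvPolynomial σ R),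
      D (f l) = (jacobianMatrix f r).det ∧ ∀ j, j ≠ l → D (f j) = 0 := by
  let A := jacobianMatrix f r
  let D : Derivation R (MvPolynomial σ R) (MvPolynomial σ R) :=
    ∑ a, A.adjugate l a • MvPolynomial.pderiv (r a)
  have hD (j : ι) : D (f j) = (A.adjugate * A) l j := by
    rw [Matrix.mul_apply, ← Derivation.coeFnAddMonoidHom_apply, map_sum, Finset.sum_apply]
    rfl
  refine ⟨D, ?_, fun j hj => ?_⟩
  · rw [hD, Matrix.adjugate_mul, Matrix.smul_apply, Matrix.one_apply_eq, smul_eq_mul, mul_one]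
  · rw [hD, Matrix.adjugate_mul, Matrix.smul_apply, Matrix.one_apply_ne hj.symm, smul_zero]

theorem isForm_det_jacobianMatrix {f : ι → MvPolynomial (Fin (n + 1)) k} {deg : ι → ℤ}
    (hf : ∀ j, IsForm (f j) (deg j)) (r : ι → Fin (n + 1)) :
    IsForm (jacobianMatrix f r).det (∑ j, deg j - Fintype.card ι) := by
  rw [Matrix.det_apply]
  refine (MvPolynomial.weightedHomogeneousSubmodule k _ _).sum_mem fun τ _ =>
    Submodule.smul_of_tower_mem _ _ ?_
  have hprod := MvPolynomial.IsWeightedHomogeneous.prod Finset.univ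
    (fun j => jacobianMatrix f r (τ j) j) (fun j => deg j - 1) (w := fun _ => (1 : ℤ))
    fun j _ => (hf j).pderiv (sub_add_cancel _ _)
  simpa using hprod

end Jacobian

theorem zero_notMem_of_isRegular {R : Type*} [CommRing R] {rs : List R}
    (h : RingTheory.Sequence.IsRegular R rs) : 0 ∉ rs := by
  intro h0
  obtain ⟨i, hi, hi0⟩ := List.getElem_of_mem h0
  have hsub := (hi0 ▸ h.regular_mod_prev i hi).subsingleton
  rw [Submodule.Quotient.subsingleton_iff] at hsub
  refine h.top_ne_smul.symm (eq_top_iff.2 (hsub.ge.trans (Submodule.smul_mono_left ?_)))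
  exact Ideal.span_mono fun x hx => List.mem_of_mem_take hx

theorem one_le_deg_of_isRegular {c : ℕ} {f : Fin c → MvPolynomial (Fin (n + 1)) k}
    {deg : Fin c → ℕ} (hf : ∀ j, (f j).IsHomogeneous (deg j))
    (hreg : RingTheory.Sequence.IsRegular S (List.ofFn f)) (j : Fin c) : 1 ≤ deg j := by
  by_contra! hj
  have hfj : f j ∈ List.ofFn f := List.mem_ofFn.2 ⟨j, rfl⟩
  have hC := hf j
  rw [Nat.lt_one_iff.1 hj, ← MvPolynomial.totalDegree_zero_iff_isHomogeneous,
    MvPolynomial.totalDegree_eq_zero_iff_eq_C] at hC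
  have hunit : IsUnit (f j) := by
    rw [hC]
    refine IsUnit.map MvPolynomial.C (isUnit_iff_ne_zero.2 fun h0 => ?_)
    rw [h0, map_zero] at hC
    exact zero_notMem_of_isRegular hreg (hC ▸ hfj)
  refine hreg.top_ne_smul ?_
  rw [Ideal.eq_top_of_isUnit_mem (Ideal.ofList (List.ofFn f)) (Ideal.subset_span hfj) hunit,
    Submodule.top_smul]

/-! ### Lowering the Frobenius twist -/

section Exponents

variable {A ι : Type*} [CommRing A] [Fintype ι]

theorem prod_pow_add_single [DecidableEq ι] (f : ι → A) (b : ι → ℕ) (l : ι) :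
    ∏ j, f j ^ (b + Pi.single l 1 : ι → ℕ) j = f l * ∏ j, f j ^ b j := by
  simp only [Pi.add_apply, pow_add, Finset.prod_mul_distrib, Pi.single_apply, pow_ite, pow_one,
    pow_zero, Finset.prod_ite_eq', Finset.mem_univ, if_true, mul_comm]

theorem prod_pow_mul_pow_mem {I : Ideal A} {f : ι → A} {a : A} {p : ℕ} {j : ι}
    (h : (f j * a) ^ p ∈ I) {b : ι → ℕ} (hj : p ≤ b j) : (∏ j, f j ^ b j) * a ^ p ∈ I := by
  refine I.mem_of_dvd (mul_pow (f j) a p ▸ mul_dvd_mul_right ?_ _) h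
  exact (pow_dvd_pow _ hj).trans (Finset.dvd_prod_of_mem (fun j => f j ^ b j) (Finset.mem_univ j))

theorem sum_mul_add_sum_lt {deg b : ι → ℕ} {l : ι} {p : ℕ} (hdeg : ∀ j, 1 ≤ deg j)
    (hb : ∀ j, b j < p) (hl : b l + 1 < p) :
    ∑ j, (b j : ℤ) * deg j + ∑ j, (deg j : ℤ) < p * ∑ j, (deg j : ℤ) := by
  rw [Finset.mul_sum, ← Finset.sum_add_distrib]
  refine Finset.sum_lt_sum (fun j _ => ?_) ⟨l, Finset.mem_univ l, ?_⟩
  · rw [← add_one_mul]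
    exact mul_le_mul_of_nonneg_right (mod_cast hb j) (Int.natCast_nonneg _)
  · rw [← add_one_mul]
    exact mul_lt_mul_of_pos_right (mod_cast hl) (mod_cast hdeg l)

end Exponents

theorem exponent_induction {ι : Type*} [Finite ι] [DecidableEq ι] {P : (ι → ℕ) → Prop} (p : ℕ)
    (hlarge : ∀ b j, p ≤ b j → P b) (htop : P fun _ => p - 1)
    (hstep : ∀ b l, (∀ j, b j < p) → b l + 1 < p → (∀ j, P (b + Pi.single j 1)) → P b)
    (b : ι → ℕ) : P b := by
  cases nonempty_fintype ι
  induction b using (measure fun b : ι → ℕ => ∑ j, (p - b j)).wf.induction with | _ b ih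
  by_cases hb : ∀ j, b j < p
  · by_cases hl : ∃ l, b l + 1 < p
    · obtain ⟨l, hl⟩ := hl
      refine hstep b l hb hl fun j => ih _ <| Finset.sum_lt_sum
        (fun i _ => Nat.sub_le_sub_left (Nat.le_add_right _ _) p) ⟨j, Finset.mem_univ j, ?_⟩
      rw [Pi.single_eq_same]
      have := hb j
      omega
    · push Not at hl
      rwa [show b = fun _ => p - 1 from funext fun j => by grind]
  · push Not at hb
    obtain ⟨j, hj⟩ := hb
    exact hlarge b j hj

section Lowering

variable {p : ℕ} [Fact p.Prime] [CharP k p] {c : ℕ} {f : Fin c → MvPolynomial (Fin (n + 1)) k}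
  {deg : Fin c → ℕ} {b : Fin c → ℕ} {l : Fin c} {m : ℕ} {v : ℤ} {a : MvPolynomial (Fin (n + 1)) k}

/-- Differentiating along a derivation dual to `f l` lowers the exponent of `f l` at the cost of a
minor of the Jacobian matrix. -/
theorem det_mul_mem_powIdeal (r : Fin c → Fin (n + 1)) (hl : b l + 1 < p)
    (h : f l * (∏ j, f j ^ b j) * a ^ p ∈ powIdeal k (Fin (n + 1)) (m * p)) :
    (jacobianMatrix f r).det * ((∏ j, f j ^ b j) * a ^ p) ∈ powIdeal k (Fin (n + 1)) (m * p) := by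
  obtain ⟨D, hDl, hD⟩ := exists_derivation_eq_det f r l
  let u := (∏ j ∈ Finset.univ.erase l, f j ^ b j) * a ^ p
  have hu : D u = 0 := by
    rw [D.leibniz, derivation_pow_char, derivation_prod_eq_zero, smul_zero, smul_zero, add_zero]
    intro j hj
    rw [D.leibniz_pow, hD j (Finset.ne_of_mem_erase hj), smul_zero, smul_zero]
  have hI : ∀ x ∈ powIdeal k (Fin (n + 1)) (m * p), D x ∈ powIdeal k (Fin (n + 1)) (m * p) :=
    fun x hx => derivation_mem_span D (by
      rintro _ ⟨i, rfl⟩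
      simp only [pow_mul, derivation_pow_char]) hx
  have hunit : IsUnit ((b l + 1 : ℕ) : S) := (CharP.isUnit_natCast_iff Fact.out).2
    fun hdvd => hl.not_ge (Nat.le_of_dvd (Nat.succ_pos _) hdvd)
  have hb : f l ^ b l * u = (∏ j, f j ^ b j) * a ^ p := by
    rw [← mul_assoc, Finset.mul_prod_erase _ (fun j => f j ^ b j) (Finset.mem_univ l)]
  rw [← hDl, ← hb]
  refine derivation_mul_pow_mul_mem D hI hu hunit ?_
  rwa [pow_succ', mul_assoc, hb, ← mul_assoc]

/-- The bound on `p` makes the degree of `(∏ j, f j ^ b j) * a ^ p` small enough to apply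
`mem_powIdeal_of_forall_mul_mem` to the Jacobian minors. -/
theorem prod_pow_mul_pow_mem_powIdeal (hf : ∀ j, (f j).IsHomogeneous (deg j))
    (hreg : RingTheory.Sequence.IsRegular S (List.ofFn f))
    (hsing : Ideal.span (Set.range MvPolynomial.X) ≤
      (jacobianIdeal f ⊔ Ideal.span (Set.range f)).radical)
    (hc : c ≤ n + 1) (hp : ((n : ℤ) + 1 - c) * (∑ j, (deg j : ℤ) - c) ≤ p) (ha : IsForm a v)
    (hv : v + ∑ j, (deg j : ℤ) < m * (n + 1)) (hb : ∀ j, b j < p) (hl : b l + 1 < p)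
    (h : ∀ j, f j * (∏ j, f j ^ b j) * a ^ p ∈ powIdeal k (Fin (n + 1)) (m * p)) :
    (∏ j, f j ^ b j) * a ^ p ∈ powIdeal k (Fin (n + 1)) (m * p) := by
  have hf' (j : Fin c) : IsForm (f j) (deg j) := isForm_of_isHomogeneous (hf j)
  have hform : IsForm ((∏ j, f j ^ b j) * a ^ p) (∑ j, (b j : ℤ) * deg j + p * v) := by
    have hprod := MvPolynomial.IsWeightedHomogeneous.prod Finset.univ (fun j => f j ^ b j)
      (fun j => b j • (deg j : ℤ)) fun j _ => (hf' j).pow (b j)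
    simpa only [nsmul_eq_mul] using hprod.mul (ha.pow p)
  let M := Set.range fun r : Fin c ↪o Fin (n + 1) => (jacobianMatrix f r).det
  have hM : ∀ x ∈ M, IsForm x (∑ j, (deg j : ℤ) - c) := by
    rintro _ ⟨r, rfl⟩
    simpa using isForm_det_jacobianMatrix hf' r
  have hcolon : Ideal.span (Set.range f) ⊔ Ideal.span M ≤
      (powIdeal k (Fin (n + 1)) (m * p)).colon {(∏ j, f j ^ b j) * a ^ p} := by
    refine sup_le (Ideal.span_le.2 ?_) (Ideal.span_le.2 ?_)
    · rintro _ ⟨j, rfl⟩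
      rw [SetLike.mem_coe, Submodule.mem_colon_singleton, smul_eq_mul, ← mul_assoc]
      exact h j
    · rintro _ ⟨r, rfl⟩
      exact Submodule.mem_colon_singleton.2 (det_mul_mem_powIdeal r hl (h l))
  refine mem_powIdeal_of_forall_mul_mem hf' hreg.toIsWeaklyRegular hc hM
    (by rwa [sup_comm]) hform ?_ fun x hx => Submodule.mem_colon_singleton.1 (hcolon hx)
  have hlt := sum_mul_add_sum_lt (one_le_deg_of_isRegular hf hreg) hb hl
  have hpv : (p : ℤ) * (v + ∑ j, (deg j : ℤ) + 1) ≤ p * (m * (n + 1)) :=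
    mul_le_mul_of_nonneg_left (by omega) (Int.natCast_nonneg _)
  push_cast
  linarith

theorem mem_powIdeal_of_prod_pow_mul_pow_mem (hf : ∀ j, (f j).IsHomogeneous (deg j))
    (hreg : RingTheory.Sequence.IsRegular S (List.ofFn f))
    (hsing : Ideal.span (Set.range MvPolynomial.X) ≤
      (jacobianIdeal f ⊔ Ideal.span (Set.range f)).radical)
    (hc : c ≤ n + 1) (hp : ((n : ℤ) + 1 - c) * (∑ j, (deg j : ℤ) - c) ≤ p) (ha : IsForm a v)
    (hv : v + ∑ j, (deg j : ℤ) < m * (n + 1))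
    (hfa : ∀ j, f j * a ∈ powIdeal k (Fin (n + 1)) m)
    (hfrob : (∏ j, f j) ^ (p - 1) * a ^ p ∈ powIdeal k (Fin (n + 1)) (m * p)) :
    a ∈ powIdeal k (Fin (n + 1)) m := by
  have hmem : (∏ j, f j ^ (0 : Fin c → ℕ) j) * a ^ p ∈ powIdeal k (Fin (n + 1)) (m * p) := by
    refine exponent_induction
      (P := fun b => (∏ j, f j ^ b j) * a ^ p ∈ powIdeal k (Fin (n + 1)) (m * p)) p
      (fun b j hj => prod_pow_mul_pow_mem (pow_mem_powIdeal_iff.2 (hfa j)) hj)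
      (by rwa [Finset.prod_pow]) (fun b l hb hl ih => ?_) 0
    refine prod_pow_mul_pow_mem_powIdeal hf hreg hsing hc hp ha hv hb hl fun j => ?_
    rw [← prod_pow_add_single]
    exact ih j
  simpa [pow_mem_powIdeal_iff] using hmem

end Lowering

/-! ### Injectivity of Frobenius -/

section Negative

variable {J : Ideal (MvPolynomial (Fin (n + 1)) k)} {q : ℕ} {z : H J q}

theorem mk_eq_zero_iff (ω : cocycles (vars J) q) :
    (Submodule.Quotient.mk ω : H J q) = 0 ↔ ω.1 ∈ coboundaries (vars J) q :=
  Submodule.Quotient.mk_eq_zero _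

theorem exists_sum_of_mem_negPart (hz : z ∈ negPart J q) :
    ∃ w : ℤ →₀ cocycles (vars J) q, (∀ t, (w t).1 ∈ cochainDeg J q t) ∧
      (∀ t, 0 ≤ t → w t = 0) ∧ Submodule.Quotient.mk (w.sum fun _ v => v) = z := by
  let 𝒜 (t : ℤ) : AddSubgroup (cocycles (vars J) q) :=
    ⨆ _ : t < 0, (cochainDeg J q t).comap (cocycles (vars J) q).subtype.toAddMonoidHom
  have hmap : negPart J q = (iSup 𝒜).map (Submodule.mkQ _).toAddMonoidHom := by
    simp only [𝒜, AddSubgroup.map_iSup]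
    rfl
  obtain ⟨ω, hω, rfl⟩ := hmap ▸ hz
  obtain ⟨w, hw, rfl⟩ := exists_finsupp_sum_eq hω
  have h𝒜 (t : ℤ) :
      𝒜 t ≤ (cochainDeg J q t).comap (cocycles (vars J) q).subtype.toAddMonoidHom :=
    iSup_le fun _ => le_rfl
  exact ⟨w, fun t => h𝒜 t (hw t), fun t ht => by
    simpa only [𝒜, not_lt.2 ht, iSup_false, AddSubgroup.mem_bot] using hw t, rfl⟩

variable {p : ℕ} [Fact p.Prime] [CharP k p]

theorem frob_mem_negPart (hz : z ∈ negPart J q) : frob J p q z ∈ negPart J q := by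
  suffices hle : negPart J q ≤ (negPart J q).comap (frob J p q) from hle hz
  refine iSup₂_le fun t ht => ?_
  rintro _ ⟨ω, hω, rfl⟩
  have hpt : (p : ℤ) * t < 0 := mul_neg_of_pos_of_neg (mod_cast Nat.Prime.pos Fact.out) ht
  exact AddSubgroup.mem_iSup_of_mem (p * t) <| AddSubgroup.mem_iSup_of_mem hpt
    ⟨frobCocycles (vars J) p (natCast_quot J p) q ω, frobCochain_mem_cochainDeg hω, rfl⟩

theorem frobCochain_mem_coboundaries_of_sum_mem (hJ : IsHomogeneousIdeal J)
    {w : ℤ →₀ Cochain (vars J) q} (hw : ∀ t, w t ∈ cochainDeg J q t)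
    (h : frobCochain (vars J) p (natCast_quot J p) q (w.sum fun _ v => v) ∈
      coboundaries (vars J) q) (t : ℤ) :
    frobCochain (vars J) p (natCast_quot J p) q (w t) ∈ coboundaries (vars J) q := by
  let F := frobCochain (vars J) p (natCast_quot J p) q
  have hinj : Function.Injective ((p : ℤ) * ·) :=
    mul_right_injective₀ (Nat.cast_ne_zero.2 (Nat.Prime.ne_zero Fact.out))
  let v := (w.mapRange F (map_zero F)).mapDomain ((p : ℤ) * ·)
  have hv (u : ℤ) : v (p * u) = F (w u) := Finsupp.mapDomain_apply hinj _ u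
  rw [← hv]
  refine mem_coboundaries_of_sum_mem hJ (fun u => ?_) ?_ _
  · by_cases hu : u ∈ Set.range ((p : ℤ) * ·)
    · obtain ⟨u, rfl⟩ := hu
      exact hv u ▸ frobCochain_mem_cochainDeg (hw u)
    · rw [Finsupp.mapDomain_of_notMem_range _ _ hu]
      exact zero_mem _
  · rwa [Finsupp.sum_mapDomain_index (fun _ => rfl) fun _ _ _ => rfl,
      Finsupp.sum_mapRange_index fun _ => rfl, ← map_finsuppSum]

theorem eq_zero_of_frob_eq_zero (hJ : IsHomogeneousIdeal J)
    (H : ∀ t < 0, ∀ ω ∈ cochainDeg J q t, d (vars J) q ω = 0 →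
      frobCochain (vars J) p (natCast_quot J p) q ω ∈ coboundaries (vars J) q →
      ω ∈ coboundaries (vars J) q)
    (hz : z ∈ negPart J q) (h0 : frob J p q z = 0) : z = 0 := by
  obtain ⟨w, hw, hw0, rfl⟩ := exists_sum_of_mem_negPart hz
  let w' := w.mapRange (cocycles (vars J) q).subtype (map_zero _)
  have hsum : (w'.sum fun _ v => v) = (w.sum fun _ v => v).1 := by
    rw [Finsupp.sum_mapRange_index fun _ => rfl, ← Submodule.coe_subtype, map_finsuppSum]
  have hF : frobCochain (vars J) p (natCast_quot J p) q (w'.sum fun _ v => v) ∈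
      coboundaries (vars J) q := by
    rw [hsum]
    exact (mk_eq_zero_iff _).1 h0
  suffices hmem : (w'.sum fun _ v => v) ∈ coboundaries (vars J) q from
    (mk_eq_zero_iff _).2 (hsum ▸ hmem)
  refine Submodule.sum_mem _ fun t _ => ?_
  obtain ht | ht := lt_or_ge t 0
  · exact H t ht _ (hw t) (w t).2 (frobCochain_mem_coboundaries_of_sum_mem hJ hw hF t)
  · rw [Finsupp.mapRange_apply, hw0 t ht]
    exact zero_mem _

end Negative

theorem mem_coboundaries_of_frobCochain_mem {p : ℕ} [Fact p.Prime] [CharP k p] {c : ℕ}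
    {f : Fin c → MvPolynomial (Fin (n + 1)) k} {deg : Fin c → ℕ}
    (hf : ∀ j, (f j).IsHomogeneous (deg j))
    (hreg : RingTheory.Sequence.IsRegular S (List.ofFn f))
    (hsing : Ideal.span (Set.range MvPolynomial.X) ≤
      (jacobianIdeal f ⊔ Ideal.span (Set.range f)).radical)
    (hp : ((n : ℤ) + 1 - c) * (∑ j, (deg j : ℤ) - c) ≤ p) {q : ℕ}
    (hq : q + c = n + 1) {t : ℤ} (ht : t < 0) {ω : Cochain (vars (Ideal.span (Set.range f))) q}
    (hωt : ω ∈ cochainDeg (Ideal.span (Set.range f)) q t)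
    (hω : d (vars (Ideal.span (Set.range f))) q ω = 0)
    (hF : frobCochain (vars (Ideal.span (Set.range f))) p (natCast_quot _ p) q ω ∈
      coboundaries (vars (Ideal.span (Set.range f))) q) :
    ω ∈ coboundaries (vars (Ideal.span (Set.range f))) q := by
  obtain ⟨η, hηt, hη, hηF⟩ := (IsCompleteIntersection.of_isWeaklyRegular
    (fun j => isForm_of_isHomogeneous (hf j)) hreg.toIsWeaklyRegular).exists_top p hq hω hωt
  obtain ⟨g, m, hg, hηg⟩ := exists_isFraction hηt
  rw [← one_mem_classAnn, hη, hηg.mem_classAnn_iff, one_mul]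
  refine mem_powIdeal_of_prod_pow_mul_pow_mem hf hreg hsing (by omega) hp hg (by linarith)
    (fun j => ?_) ?_
  · rw [← hηg.mem_classAnn_iff, ← hη]
    exact le_classAnn ω (Ideal.subset_span ⟨j, rfl⟩)
  · have h1 := (hηF 1).1 (one_mem_classAnn.2 hF)
    rwa [(hηg.frobCochain p).mem_classAnn_iff, one_mul] at h1

end CI

end

theorem theorem3p5_general (p : ℕ) [Fact p.Prime] (k : Type*) [Field k] [CharP k p] (n c : ℕ)
    (f : Fin c → MvPolynomial (Fin (n + 1)) k) (deg : Fin c → ℕ)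
    (hf : ∀ j, (f j).IsHomogeneous (deg j))
    (hreg : RingTheory.Sequence.IsRegular (MvPolynomial (Fin (n + 1)) k) (List.ofFn f))
    (hsing : Ideal.span (Set.range MvPolynomial.X) ≤
      (CI.jacobianIdeal f ⊔ Ideal.span (Set.range f)).radical)
    (hp : ((n : ℤ) + 1 - c) * ((∑ j, (deg j : ℤ)) - c) ≤ p) :
    Set.MapsTo (CI.frob (Ideal.span (Set.range f)) p (n + 1 - c))
        (CI.negPart (Ideal.span (Set.range f)) (n + 1 - c))
        (CI.negPart (Ideal.span (Set.range f)) (n + 1 - c)) ∧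
      Set.InjOn (CI.frob (Ideal.span (Set.range f)) p (n + 1 - c))
        (CI.negPart (Ideal.span (Set.range f)) (n + 1 - c)) := by
  have hJ := (CI.IsCompleteIntersection.of_isWeaklyRegular
    (fun j => CI.isForm_of_isHomogeneous (hf j)) hreg.toIsWeaklyRegular).isHomogeneousIdeal
  refine ⟨fun z hz => CI.frob_mem_negPart hz, fun z hz w hw hzw => sub_eq_zero.1 ?_⟩
  refine CI.eq_zero_of_frob_eq_zero (p := p) hJ (fun t ht ω hωt hω hF => ?_) (sub_mem hz hw) ?_
  · obtain hc | hc := le_or_gt c (n + 1)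
    · exact CI.mem_coboundaries_of_frobCochain_mem hf hreg hsing hp (Nat.sub_add_cancel hc)
        ht hωt hω hF
    · generalize hq : n + 1 - c = q at *
      obtain rfl : q = 0 := by omega
      exact CI.eq_zero_of_mem_cochainDeg_zero ht hωt ▸ zero_mem _
  · rw [map_sub, hzw, sub_self]

theorem theorem3p5 (p : ℕ) [Fact p.Prime] (k : Type*) [Field k] [CharP k p]
    (hk : (frobenius k p).Finite) (n c : ℕ)
    (f : Fin c → MvPolynomial (Fin (n + 1)) k) (deg : Fin c → ℕ)
    (hf : ∀ j, (f j).IsHomogeneous (deg j))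
    (hreg : RingTheory.Sequence.IsRegular (MvPolynomial (Fin (n + 1)) k) (List.ofFn f))
    (hsing : (CI.jacobianIdeal f ⊔ Ideal.span (Set.range f)).radical =
      Ideal.span (Set.range MvPolynomial.X))
    (hp : ((n : ℤ) + 1 - c) * ((∑ j, (deg j : ℤ)) - c) ≤ p) :
    Set.MapsTo (CI.frob (Ideal.span (Set.range f)) p (n + 1 - c))
        (CI.negPart (Ideal.span (Set.range f)) (n + 1 - c))
        (CI.negPart (Ideal.span (Set.range f)) (n + 1 - c)) ∧
      Set.InjOn (CI.frob (Ideal.span (Set.range f)) p (n + 1 - c))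
        (CI.negPart (Ideal.span (Set.range f)) (n + 1 - c)) :=
  theorem3p5_general p k n c f deg hf hreg hsing.ge hp
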